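/- Let $\tilde{\mathcal O}=\mathbb R\times\mathbb R^+$ with coordinates $(x_1,x_2)$, $x_2>0$, let $\omega=dx_1\wedge dx_2=\frac12\omega_{ij}dx_i\wedge dx_j$, let $(\omega^{ij})$ be the inverse matrix of $(\omega_{ij})$, and let $C^\infty(\tilde{\mathcal O})$ be the algebra of smooth complex valued functions. Let $\nabla^{\tilde{\mathcal O}}$ be the flat torsion free symplectic connection $$\nabla_{\partial_1}\partial_1=0,\qquad \nabla_{\partial_1}\partial_2=\nabla_{\partial_2}\partial_1=\tfrac{1}{2x_2}\partial_1,\qquad \nabla_{\partial_2}\partial_2=-\tfrac1{2x_2}\partial_2 ,$$ with Christoffel symbols $\Gamma^m_{jk}$, and put $\Gamma_{ijk}=\omega_{im}\Gamma^m_{jk}$, $\Gamma=\frac12\Gamma_{ijk}y^iy^jdx_k$. *Fedosov's star product.* Let $W$ be the space of formal sums $a=\sum_{k,\alpha}\hbar^k a_{k,\alpha}y^\alpha$, with $a_{k,\alpha}\in C^\infty(\tilde{\mathcal O})$ and $y=(y^1,y^2)$, with the product $$a\circ b=\sum_{m\ge0}\frac{1}{m!}\Big(-\frac{i\hbar}{2}\Big)^m\omega^{i_1j_1}\cdots\omega^{i_mj_m}\frac{\partial^m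 a}{\partial y^{i_1}\cdots\partial y^{i_m}}\frac{\partial^m b}{\partial y^{j_1}\cdots\partial y^{j_m}},$$ extended to $W$-valued differential forms, with graded commutator $[\cdot,\cdot]$. For a $W$-valued $1$-form $r=r_1dx_1+r_2dx_2$ put $$Da=-\delta a+da+\tfrac{i}{\hbar}[\Gamma,a]+\tfrac i\hbar[r,a],\qquad \delta a=dx_k\wedge\frac{\partial a}{\partial y^k},$$ so that $D=d+\frac i\hbar[\gamma,\cdot]$ with $\gamma=\omega_{ij}y^idx_j+\Gamma+r$. Let $\Omega=d\gamma+\frac i\hbar\gamma\circ\gamma$ be the Weyl curvature of $D$; when $\Omega$ is scalar, that is, free of $y$, $\frac i\hbar\Omega$ is called the characteristic form of $D$. Call $r$ *admissible* if $D^2=0$, the characteristic form is $\frac1{i\hbar}\omega$ (that is, $\Omega=-\omega$), $r$ has only terms of degree $\ge3$ (where $\deg y^k=1$, $\deg\hbar=2$), and $y^1r_1+y^2r_2=0$ (Fedosov's normalisation). For $a\in W$ let $\sigma(a)=a|_{y=0}\in C^\infty(\tilde{\mathcal O})[[\hbar]]$. *The reduced Rankin–Cohen deformation.* Let $X=\frac1{x_2}\partial_{x_1}$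 and $Y=-x_2\partial_{x_2}$, so that $[Y,X]=X$, let $(\alpha)_k=\alpha(\alpha+1)\cdots(\alpha+k-1)$, and for $f,g\in C^\infty(\tilde{\mathcal O})$ let $$RC_n(f,g)=\sum_{k=0}^n\frac{(-1)^k}{k!}X^k(2Y+k)_{n-k}(f)\cdot\frac1{(n-k)!}X^{n-k}(2Y+n-k)_k(g),$$ extended $\mathbb C[[\hbar]]$-bilinearly to $C^\infty(\tilde{\mathcal O})[[\hbar]]$. The deformation is $\sum_{n\ge0}t^nRC_n$, with formal parameter $t$. **Corollary.** There is exactly one admissible $r$. For this $r$, every $f\in C^\infty(\tilde{\mathcal O})[[\hbar]]$ is $\sigma(a)$ for exactly one $a\in W$ with $Da=0$, denoted $\sigma^{-1}(f)$; and Fedosov's star product $f\star g=\sigma(\sigma^{-1}(f)\circ\sigma^{-1}(g))$ is the reduced Rankin–Cohen deformation with $t=\frac{i\hbar}{4}$: $$f\star g=\sum_{n\ge0}\Big(\frac{i\hbar}{4}\Big)^nRC_n(f,g)\qquad\text{for all } f,g\in C^\infty(\tilde{\mathcal O})[[\hbar]].$$ -/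

import Mathlib

noncomputable section

namespace RankinCohenFedosov

open scoped ContDiff PowerSeries

/-! ### The symplectic manifold `Õ = ℝ × ℝ⁺` and its smooth functions -/

/-- The open half plane `Õ = ℝ × ℝ⁺`, with global coordinates `x₁` (first) and `x₂ > 0` (second).
Indices `1, 2` of coordinates are the elements `0, 1` of `Fin 2`. -/
def Otilde : Set (ℝ × ℝ) := {x | 0 < x.2}

theorem isOpen_Otilde : IsOpen Otilde := isOpen_lt continuous_const continuous_snd

/-- Extension by zero of a function on `Õ` to the plane (only its values on the open set `Õ`
are ever used). -/
def ext (f : Otilde → ℂ) : ℝ × ℝ → ℂ := Function.extend Subtype.val f 0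

theorem ext_apply (f : Otilde → ℂ) {x : ℝ × ℝ} (hx : x ∈ Otilde) : ext f x = f ⟨x, hx⟩ :=
  Subtype.val_injective.extend_apply f 0 ⟨x, hx⟩

theorem contDiffOn_ext {f : Otilde → ℂ} {g : ℝ × ℝ → ℂ} (hg : ContDiffOn ℝ ∞ g Otilde)
    (h : ∀ x : Otilde, f x = g x) : ContDiffOn ℝ ∞ (ext f) Otilde :=
  hg.congr fun x hx => by rw [ext_apply f hx, h]

/-- The algebra `C^∞(Õ)` of smooth complex valued functions on `Õ`. -/
def smoothFunctions : Subalgebra ℂ (Otilde → ℂ) where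
  carrier := {f | ContDiffOn ℝ ∞ (ext f) Otilde}
  mul_mem' {f g} hf hg := contDiffOn_ext (hf.mul hg) fun x => by
    simp [ext_apply _ x.2]
  add_mem' {f g} hf hg := contDiffOn_ext (hf.add hg) fun x => by
    simp [ext_apply _ x.2]
  algebraMap_mem' c := contDiffOn_ext (contDiffOn_const (c := c)) fun _ => rfl

/-- `C^∞(Õ)` as a type; it is a commutative `ℂ`-algebra under pointwise operations. -/
abbrev Smooth : Type := smoothFunctions

/-- The coordinate vectors of the plane. -/
def basisVec : Fin 2 → ℝ × ℝ := ![(1, 0), (0, 1)]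

theorem differentiableAt_ext (f : Smooth) (x : Otilde) :
    DifferentiableAt ℝ (ext f) (x : ℝ × ℝ) :=
  ((f.2 : ContDiffOn ℝ ∞ (ext f) Otilde).differentiableOn (by simp)).differentiableAt
    (isOpen_Otilde.mem_nhds x.2)

/-- The partial derivative `∂/∂x_k : C^∞(Õ) → C^∞(Õ)`. -/
def partialX (k : Fin 2) : Module.End ℂ Smooth where
  toFun f := ⟨fun x => fderiv ℝ (ext f) x (basisVec k), contDiffOn_ext
    (((f.2 : ContDiffOn ℝ ∞ (ext f) Otilde).fderiv_of_isOpen isOpen_Otilde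
      (m := ∞) (by simp)).clm_apply contDiffOn_const) fun _ => rfl⟩
  map_add' f g := by
    ext x
    have h : ext (f + g : Smooth) =ᶠ[nhds (x : ℝ × ℝ)] ext f + ext g := by
      filter_upwards [isOpen_Otilde.mem_nhds x.2] with y hy
      simp [ext_apply _ hy]
    change fderiv ℝ (ext (f + g : Smooth)) x (basisVec k)
      = fderiv ℝ (ext f) x (basisVec k) + fderiv ℝ (ext g) x (basisVec k)
    rw [h.fderiv_eq, fderiv_add (differentiableAt_ext f x) (differentiableAt_ext g x)]
    rfl
  map_smul' c f := by
    ext x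
    have h : ext (c • f : Smooth) =ᶠ[nhds (x : ℝ × ℝ)] c • ext f := by
      filter_upwards [isOpen_Otilde.mem_nhds x.2] with y hy
      simp [ext_apply _ hy]
    change fderiv ℝ (ext (c • f : Smooth)) x (basisVec k) = c • fderiv ℝ (ext f) x (basisVec k)
    rw [h.fderiv_eq, fderiv_const_smul (differentiableAt_ext f x)]
    rfl

/-- The coordinate function `x₂`. -/
def x₂ : Smooth := ⟨fun x => ((x : ℝ × ℝ).2 : ℂ), contDiffOn_ext
  (g := fun x : ℝ × ℝ => (x.2 : ℂ)) (Complex.ofRealCLM.contDiff.comp contDiff_snd).contDiffOn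
  fun _ => rfl⟩

/-- The function `1 / x₂`, smooth on `Õ`. -/
def invX₂ : Smooth := ⟨fun x => ((x : ℝ × ℝ).2 : ℂ)⁻¹, contDiffOn_ext
  (g := fun x : ℝ × ℝ => (x.2 : ℂ)⁻¹)
  ((Complex.ofRealCLM.contDiff.comp contDiff_snd).contDiffOn.inv fun x hx => by
    simpa using (ne_of_gt hx : x.2 ≠ 0)) fun _ => rfl⟩

theorem x₂_mul_invX₂ : x₂ * invX₂ = 1 := by
  ext x
  have hx : ((x : ℝ × ℝ).2 : ℂ) ≠ 0 := by exact_mod_cast (ne_of_gt x.2 : (x : ℝ × ℝ).2 ≠ 0)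
  exact mul_inv_cancel₀ hx

/-- The matrix `ω_{ij}` of the symplectic form `ω = dx₁ ∧ dx₂ = ½ ∑ ω_{ij} dx_i ∧ dx_j`. -/
def omega : Matrix (Fin 2) (Fin 2) ℂ := !![0, 1; -1, 0]

/-- The inverse matrix `ω^{ij}` of `ω_{ij}`. -/
def omegaInv : Matrix (Fin 2) (Fin 2) ℂ := !![0, -1; 1, 0]

theorem omega_mul_omegaInv : omega * omegaInv = 1 := by
  ext i j; fin_cases i <;> fin_cases j <;> simp [omega, omegaInv]

/-- A torsion free symplectic connection on `(Õ, dx₁ ∧ dx₂)`, given by its Christoffel symbols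
`Γ m i j = Γ^m_{ij}`, that is, `∇_{∂_i} ∂_j = ∑_m Γ^m_{ij} ∂_m`. The last field is
`(∇_{∂_k} ω)(∂_i, ∂_j) = 0`. -/
structure SymplecticConnection where
  Γ : Fin 2 → Fin 2 → Fin 2 → Smooth
  torsionFree : ∀ m i j, Γ m i j = Γ m j i
  symplectic : ∀ k i j,
    partialX k (algebraMap ℂ Smooth (omega i j))
      - ∑ m, (omega m j • Γ m k i + omega i m • Γ m k j) = 0

theorem partialX_algebraMap (k : Fin 2) (c : ℂ) : partialX k (algebraMap ℂ Smooth c) = 0 := by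
  ext x
  have h : ext (algebraMap ℂ Smooth c : Smooth) =ᶠ[nhds (x : ℝ × ℝ)] fun _ => c := by
    filter_upwards [isOpen_Otilde.mem_nhds x.2] with y hy
    rw [ext_apply _ hy]; rfl
  change fderiv ℝ (ext (algebraMap ℂ Smooth c : Smooth)) x (basisVec k) = 0
  rw [h.fderiv_eq]
  simp

/-- The connection `∇^{Õ}`: `∇_{∂₁} ∂₁ = 0`, `∇_{∂₁} ∂₂ = ∇_{∂₂} ∂₁ = (1 / (2 x₂)) ∂₁`,
`∇_{∂₂} ∂₂ = -(1 / (2 x₂)) ∂₂`. -/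
def flatConnection : SymplecticConnection where
  Γ := ![![![0, (1 / 2 : ℂ) • invX₂], ![(1 / 2 : ℂ) • invX₂, 0]],
         ![![0, 0], ![0, -((1 / 2 : ℂ) • invX₂)]]]
  torsionFree m i j := by fin_cases m <;> fin_cases i <;> fin_cases j <;> rfl
  symplectic k i j := by
    rw [partialX_algebraMap]
    fin_cases k <;> fin_cases i <;> fin_cases j <;> simp [omega]

/-! ### The Weyl algebra bundle -/

/-- Formal functions `C^∞(Õ)[[ħ]]`; the power series variable is `ħ`. -/
abbrev FormalFunctions : Type := Smooth⟦X⟧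

/-- Smooth sections of the Weyl algebra bundle: `∑ ħ^k a_{k,α} y^α`, where `k ∈ ℕ`, `α` is a
multi-index in the fibre coordinates `(y¹, y²)`, and `a_{k,α} ∈ C^∞(Õ)`. The outer power series
variable is `ħ`. -/
abbrev Weyl : Type := (MvPowerSeries (Fin 2) Smooth)⟦X⟧

/-- `∂/∂y^k` on sections of the Weyl bundle. -/
def partialY (k : Fin 2) (a : Weyl) : Weyl :=
  PowerSeries.mk fun n => MvPowerSeries.pderiv Smooth k (PowerSeries.coeff n a)

/-- The coefficientwise derivative `∂/∂x_k` on sections of the Weyl bundle. -/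
def dX (k : Fin 2) (a : Weyl) : Weyl :=
  PowerSeries.mk fun n => fun α => partialX k (MvPowerSeries.coeff α (PowerSeries.coeff n a))

/-- The fibre coordinate `y^k`, as a section of the Weyl bundle. -/
def yVar (k : Fin 2) : Weyl := PowerSeries.C (MvPowerSeries.X k)

/-- A smooth function on `Õ`, as a section of the Weyl bundle. -/
def ofSmooth (f : Smooth) : Weyl := PowerSeries.C (MvPowerSeries.C f)

/-- The iterated derivative `∂^m / ∂y^{i₁} ⋯ ∂y^{i_m}`. -/
def iterPartialY {m : ℕ} (i : Fin m → Fin 2) (f : MvPowerSeries (Fin 2) Smooth) :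
    MvPowerSeries (Fin 2) Smooth :=
  (List.ofFn i).foldr (fun j g => MvPowerSeries.pderiv Smooth j g) f

/-- The fibrewise product
`a ∘ b = ∑_m (-iħ/2)^m / m! ω^{i₁j₁} ⋯ ω^{i_m j_m} ∂^m a/∂y^{i₁}⋯∂y^{i_m} ∂^m b/∂y^{j₁}⋯∂y^{j_m}`. -/
def weylMul (a b : Weyl) : Weyl :=
  PowerSeries.mk fun n => ∑ m ∈ Finset.range (n + 1), ∑ p ∈ Finset.HasAntidiagonal.antidiagonal (n - m),
    ((-Complex.I / 2) ^ m / (m.factorial : ℂ)) •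
      ∑ i : Fin m → Fin 2, ∑ j : Fin m → Fin 2, (∏ s, omegaInv (i s) (j s)) •
        (iterPartialY i (PowerSeries.coeff p.1 a) * iterPartialY j (PowerSeries.coeff p.2 b))

/-- The operation `(i/ħ) [a, b] = (i/ħ) (a ∘ b - b ∘ a)`; the division by `ħ` is exact, see
`X_mul_iBracket`. -/
def iBracket (a b : Weyl) : Weyl :=
  PowerSeries.mk fun n =>
    Complex.I • PowerSeries.coeff (n + 1) (weylMul a b - weylMul b a)

theorem coeff_zero_weylMul (a b : Weyl) : PowerSeries.coeff 0 (weylMul a b) =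
    PowerSeries.coeff 0 a * PowerSeries.coeff 0 b := by
  rw [weylMul, PowerSeries.coeff_mk, Finset.sum_range_one, Nat.sub_self,
    Finset.HasAntidiagonal.antidiagonal_zero, Finset.sum_singleton, Fintype.sum_unique, Fintype.sum_unique,
    Fin.prod_univ_zero, pow_zero, Nat.factorial_zero, Nat.cast_one, div_one, one_smul, one_smul]
  rfl

theorem X_mul_iBracket (a b : Weyl) :
    PowerSeries.X * iBracket a b = Complex.I • (weylMul a b - weylMul b a) := by
  ext1 n
  cases n with
  | zero =>
    rw [PowerSeries.coeff_zero_X_mul]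
    change 0 = Complex.I • (PowerSeries.coeff 0 (weylMul a b) - PowerSeries.coeff 0 (weylMul b a))
    rw [coeff_zero_weylMul, coeff_zero_weylMul, mul_comm, sub_self, smul_zero]
  | succ n =>
    rw [PowerSeries.coeff_succ_X_mul, iBracket, PowerSeries.coeff_mk]
    rfl

/-! ### Fedosov connections

A `1`-form `b₁ dx₁ + b₂ dx₂` with values in the Weyl bundle is the pair `b : Fin 2 → Weyl`; a
`2`-form is its coefficient in front of `dx₁ ∧ dx₂`; there are no forms of higher degree. -/

/-- `Γ_{ijk} = ∑_m ω_{im} Γ^m_{jk}`. -/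
def christoffelLower (N : SymplecticConnection) (i j k : Fin 2) : Smooth :=
  ∑ m, omega i m • N.Γ m j k

/-- The `dx_k` component of the `1`-form `Γ = ½ ∑ Γ_{ijk} y^i y^j dx_k`. -/
def gammaForm (N : SymplecticConnection) (k : Fin 2) : Weyl :=
  (1 / 2 : ℂ) • ∑ i, ∑ j, ofSmooth (christoffelLower N i j k) * (yVar i * yVar j)

/-- The component in direction `dx_k` of `D a = -δ a + ∂ a + (i/ħ) [r, a]` on sections, where
`δ a = ∑ dx_k ∧ ∂a/∂y^k` and `∂ a = d a + (i/ħ) [Γ, a]`. -/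
def fedosovD (N : SymplecticConnection) (r : Fin 2 → Weyl) (k : Fin 2) (a : Weyl) : Weyl :=
  -partialY k a + (dX k a + iBracket (gammaForm N k) a) + iBracket (r k) a

/-- The same operator `D` on `1`-forms: the coefficient of `dx₁ ∧ dx₂` in `D b` (the bracket is
the graded commutator). -/
def fedosovD₁ (N : SymplecticConnection) (r : Fin 2 → Weyl) (b : Fin 2 → Weyl) : Weyl :=
  fedosovD N r 0 (b 1) - fedosovD N r 1 (b 0)

/-- The full connection form `γ = ∑ ω_{ik} y^i dx_k + Γ + r`, for which `D = d + (i/ħ) [γ, ·]`: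
its `dx_k` component. -/
def connectionForm (N : SymplecticConnection) (r : Fin 2 → Weyl) (k : Fin 2) : Weyl :=
  ∑ i, omega i k • yVar i + gammaForm N k + r k

/-- The Weyl curvature `Ω = d γ + (i/ħ) γ ∘ γ` of `D`: its coefficient of `dx₁ ∧ dx₂`
(`γ ∘ γ = [γ₁, γ₂] dx₁ ∧ dx₂`). -/
def weylCurvature (N : SymplecticConnection) (r : Fin 2 → Weyl) : Weyl :=
  dX 0 (connectionForm N r 1) - dX 1 (connectionForm N r 0)
    + iBracket (connectionForm N r 0) (connectionForm N r 1)

/-- A formal function, as a central section of the Weyl bundle. -/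
def central (f : FormalFunctions) : Weyl := PowerSeries.map MvPowerSeries.C f

/-- The symplectic form `ω = dx₁ ∧ dx₂` as a formal `2`-form (coefficient of `dx₁ ∧ dx₂`). -/
def omegaForm : FormalFunctions := PowerSeries.C (algebraMap ℂ Smooth (omega 0 1))

/-- `r` is the `1`-form of Fedosov's construction for the connection `N` and the Weyl curvature
`Ω`, that is, for the characteristic form `(i/ħ) Ω` (so `Ω = -ω` is characteristic form
`ω / (iħ)`): the Weyl curvature is `Ω`, `D` is abelian, and `r` is normalised in Fedosov's way,
namely it has degree at least `3` (where `deg y^k = 1`, `deg ħ = 2`), and `δ* r = 0`, where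
`δ* r = y¹ r₁ + y² r₂`. -/
structure IsFedosovForm (N : SymplecticConnection) (Ω : FormalFunctions) (r : Fin 2 → Weyl) :
    Prop where
  curvature : weylCurvature N r = central Ω
  abelian : ∀ a : Weyl, fedosovD₁ N r (fun k => fedosovD N r k a) = 0
  degree : ∀ (k : Fin 2) (n : ℕ) (α : Fin 2 →₀ ℕ), 2 * n + α.degree < 3 →
    MvPowerSeries.coeff α (PowerSeries.coeff n (r k)) = 0
  normalised : ∑ k, yVar k * r k = 0

/-- `W_D`: the flat sections of `D`. -/
def IsFlatSection (N : SymplecticConnection) (r : Fin 2 → Weyl) (a : Weyl) : Prop :=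
  ∀ k, fedosovD N r k a = 0

/-- `σ(a) = a(x, 0, ħ)`. -/
def sigma (a : Weyl) : FormalFunctions := PowerSeries.map MvPowerSeries.constantCoeff a

/-- `σ⁻¹(f)`: the flat section `a` with `σ(a) = f`. -/
def sigmaInv (N : SymplecticConnection) (r : Fin 2 → Weyl) (f : FormalFunctions) : Weyl :=
  Classical.epsilon fun a => IsFlatSection N r a ∧ sigma a = f

/-- Fedosov's star product `f ⋆ g = σ(σ⁻¹(f) ∘ σ⁻¹(g))`. -/
def fedosovStar (N : SymplecticConnection) (r : Fin 2 → Weyl) (f g : FormalFunctions) :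
    FormalFunctions :=
  sigma (weylMul (sigmaInv N r f) (sigmaInv N r g))

/-! ### The reduced Rankin–Cohen deformation -/

/-- `X = (1 / x₂) ∂/∂x₁` acting on `C^∞(Õ)`. -/
def opX : Module.End ℂ Smooth := LinearMap.mulLeft ℂ invX₂ * partialX 0

/-- `Y = -x₂ ∂/∂x₂` acting on `C^∞(Õ)`. -/
def opY : Module.End ℂ Smooth := -(LinearMap.mulLeft ℂ x₂ * partialX 1)

/-- `(T)_k = T (T + 1) ⋯ (T + k - 1)` for an operator `T`. -/
def pochhammer (T : Module.End ℂ Smooth) (k : ℕ) : Module.End ℂ Smooth :=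
  Polynomial.aeval T (ascPochhammer ℂ k)

/-- The Rankin–Cohen bracket
`RC_n(a, b) = ∑_k (-1)^k/k! X^k (2Y+k)_{n-k}(a) · 1/(n-k)! X^{n-k} (2Y+n-k)_k(b)`. -/
def rankinCohen (n : ℕ) (a b : Smooth) : Smooth :=
  ∑ k ∈ Finset.range (n + 1),
    (((-1 : ℂ) ^ k / (k.factorial : ℂ)) •
      (opX ^ k) (pochhammer ((2 : ℂ) • opY + (k : ℂ) • (1 : Module.End ℂ Smooth)) (n - k) a)) *
    ((1 / ((n - k).factorial : ℂ)) •
      (opX ^ (n - k))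
        (pochhammer ((2 : ℂ) • opY + ((n - k : ℕ) : ℂ) • (1 : Module.End ℂ Smooth)) k b))

/-- The reduced Rankin–Cohen deformation `∑_n t^n RC_n` with formal parameter `t = c ħ`,
extended `ℂ[[ħ]]`-bilinearly (and `ħ`-adically continuously) to formal functions. -/
def rcDeformation (c : ℂ) (f g : FormalFunctions) : FormalFunctions :=
  PowerSeries.mk fun N => ∑ n ∈ Finset.range (N + 1), ∑ p ∈ Finset.HasAntidiagonal.antidiagonal (N - n),
    c ^ n • rankinCohen n (PowerSeries.coeff p.1 f) (PowerSeries.coeff p.2 g)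

end RankinCohenFedosov

end

/-!
Since the connection is flat and torsion free, the form `ω_{ij} y^i dx_j + Γ` already has Weyl
curvature `-ω`, so `r = 0` is a Fedosov form (`isFedosovForm_zero`). It is the only one
(`IsFedosovForm.eq_zero`): for another solution `r`, the curvature equation says that `δ r` is
determined by terms of higher degree, so the term of lowest degree of `r` is annihilated by `δ`;
it is also annihilated by `δ*`, and `δ δ* + δ* δ` is multiplication by the total degree in the
`y^k` and `dx_k`.

For `r = 0` the bracket with the quadratic form `Γ` is the fibrewise Poisson bracket, so the
equations for a flat section do not involve `ħ`. Writing `A_{j,k}` for the derivative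
`(∂/∂y¹)^j (∂/∂y²)^k a` at `y = 0`, they become the recursions
`A_{j,k+1} = (∂/∂x₂ - (j - k)/(2 x₂)) A_{j,k}` and
`A_{j+1,k} = ∂/∂x₁ A_{j,k} - k/(2 x₂) A_{j+1,k-1}`. The relation `[Y, X] = X` shows that their
unique solution with `A_{0,0} = f` is `(-1/2)^k x₂^{j-k} X^j (2Y + j)_k f` (`flatJet`,
`flat_iff_jet`), which gives existence and uniqueness of flat sections.

The `m`-th term of the fibrewise product is the binomial expansion of
`(∂/∂y² ⊗ ∂/∂y¹ - ∂/∂y¹ ⊗ ∂/∂y²)^m` (`bidiff_eq_sum`). Inserting the jets of two flat sections, the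
powers of `x₂` cancel and the sum is the bracket `RC_m` term by term, with the scalar
`(-iħ/2)^m (-1/2)^m = (iħ/4)^m` (`constantCoeff_bidiff`).
-/

namespace RankinCohenFedosov

open scoped ContDiff PowerSeries

noncomputable section

/-! ### Calculus of smooth functions on the half plane -/

theorem partialX_apply (k : Fin 2) (f : Smooth) (x : Otilde) :
    (partialX k f : Otilde → ℂ) x = fderiv ℝ (ext f) x (basisVec k) := rfl

theorem ext_eventuallyEq {f : Otilde → ℂ} {g : ℝ × ℝ → ℂ} (h : ∀ x : Otilde, f x = g x)
    (x : Otilde) : ext f =ᶠ[nhds (x : ℝ × ℝ)] g := by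
  filter_upwards [isOpen_Otilde.mem_nhds x.2] with y hy
  rw [ext_apply f hy, h]

theorem partialX_mul (k : Fin 2) (f g : Smooth) :
    partialX k (f * g) = f * partialX k g + g * partialX k f := by
  ext x
  have h : ext (f * g : Smooth) =ᶠ[nhds (x : ℝ × ℝ)] ext f * ext g :=
    ext_eventuallyEq (fun x => by simp [ext_apply _ x.2]) x
  have hf : ext f x = (f : Otilde → ℂ) x := ext_apply _ x.2
  have hg : ext g x = (g : Otilde → ℂ) x := ext_apply _ x.2
  change fderiv ℝ (ext (f * g : Smooth)) x (basisVec k) =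
    (f : Otilde → ℂ) x * fderiv ℝ (ext g) x (basisVec k) +
      (g : Otilde → ℂ) x * fderiv ℝ (ext f) x (basisVec k)
  rw [h.fderiv_eq, fderiv_mul (differentiableAt_ext f x) (differentiableAt_ext g x)]
  simp [hf, hg]

/-- Symmetry of second derivatives. -/
theorem partialX_comm (i j : Fin 2) (f : Smooth) :
    partialX i (partialX j f) = partialX j (partialX i f) := by
  ext x
  have hc : ContDiffAt ℝ ∞ (ext f) (x : ℝ × ℝ) :=
    (f.2 : ContDiffOn ℝ ∞ (ext f) Otilde).contDiffAt (isOpen_Otilde.mem_nhds x.2)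
  have hd : DifferentiableAt ℝ (fderiv ℝ (ext f)) (x : ℝ × ℝ) :=
    (hc.fderiv_right (m := ∞) (by simp)).differentiableAt (by simp)
  have key (i j : Fin 2) : (partialX i (partialX j f) : Otilde → ℂ) x =
      fderiv ℝ (fderiv ℝ (ext f)) x (basisVec i) (basisVec j) := by
    rw [partialX_apply, (ext_eventuallyEq (g := fun y => fderiv ℝ (ext f) y (basisVec j))
      (fun y => partialX_apply j f y) x).fderiv_eq,
      fderiv_clm_apply hd (differentiableAt_const _)]
    simp
  rw [key, key]
  exact hc.isSymmSndFDerivAt (by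
    rw [minSmoothness_of_isRCLikeNormedField]; exact WithTop.coe_le_coe.2 (le_top : (2 : ℕ∞) ≤ ⊤)) _ _

theorem partialX_one (k : Fin 2) : partialX k 1 = 0 := by
  simpa using partialX_algebraMap k 1

theorem partialX_x₂ (k : Fin 2) : partialX k x₂ = if k = 1 then 1 else 0 := by
  ext x
  rw [partialX_apply, (ext_eventuallyEq (f := x₂) (g := fun x : ℝ × ℝ => (x.2 : ℂ))
    (fun y => rfl) x).fderiv_eq]
  have h : HasFDerivAt (fun x : ℝ × ℝ => (x.2 : ℂ))
      (Complex.ofRealCLM.comp (ContinuousLinearMap.snd ℝ ℝ ℝ)) (x : ℝ × ℝ) :=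
    (Complex.ofRealCLM.comp (ContinuousLinearMap.snd ℝ ℝ ℝ)).hasFDerivAt
  rw [h.fderiv]
  fin_cases k <;> simp [basisVec]

theorem partialX_invX₂ (k : Fin 2) :
    partialX k invX₂ = if k = 1 then -(invX₂ * invX₂) else 0 := by
  have h := congrArg (partialX k) x₂_mul_invX₂
  rw [partialX_mul, partialX_one, partialX_x₂] at h
  have h1 := x₂_mul_invX₂
  split_ifs at h ⊢
  · linear_combination invX₂ * h - partialX k invX₂ * h1
  · linear_combination invX₂ * h - partialX k invX₂ * h1

theorem partialX_zero_pow_x₂ (j : ℕ) : partialX 0 (x₂ ^ j) = 0 := by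
  induction j with
  | zero => rw [pow_zero, partialX_one]
  | succ j ih => simp [pow_succ, partialX_mul, ih, partialX_x₂]

theorem partialX_zero_pow_invX₂ (j : ℕ) : partialX 0 (invX₂ ^ j) = 0 := by
  induction j with
  | zero => rw [pow_zero, partialX_one]
  | succ j ih => simp [pow_succ, partialX_mul, ih, partialX_invX₂]

theorem partialX_one_pow_x₂ (j : ℕ) : partialX 1 (x₂ ^ j) = (j : ℂ) • (invX₂ * x₂ ^ j) := by
  have h1 := x₂_mul_invX₂
  simp only [Algebra.smul_def, map_natCast]
  induction j with
  | zero => simp [partialX_one]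
  | succ j ih =>
    simp only [pow_succ, partialX_mul, ih, partialX_x₂, if_true]
    push_cast
    linear_combination (-x₂ ^ j) * h1

theorem partialX_one_pow_invX₂ (j : ℕ) :
    partialX 1 (invX₂ ^ j) = -((j : ℂ) • (invX₂ * invX₂ ^ j)) := by
  simp only [Algebra.smul_def, map_natCast]
  induction j with
  | zero => simp [partialX_one]
  | succ j ih =>
    simp only [pow_succ, partialX_mul, ih, partialX_invX₂, if_true]
    push_cast
    ring

theorem opX_apply (f : Smooth) : opX f = invX₂ * partialX 0 f := rfl

theorem opY_apply (f : Smooth) : opY f = -(x₂ * partialX 1 f) := rfl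

theorem partialX_zero_eq (f : Smooth) : partialX 0 f = x₂ * opX f := by
  rw [opX_apply]
  linear_combination (-partialX 0 f) * x₂_mul_invX₂

theorem partialX_one_eq (f : Smooth) : partialX 1 f = -(invX₂ * opY f) := by
  rw [opY_apply]
  linear_combination (-partialX 1 f) * x₂_mul_invX₂

/-- The relation `[Y, X] = X`. -/
theorem opY_opX (f : Smooth) : opY (opX f) = opX (opY f) + opX f := by
  have h1 := x₂_mul_invX₂
  simp only [opX_apply, opY_apply, map_neg, partialX_mul, partialX_x₂, partialX_invX₂,
    partialX_comm 1 0]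
  simp
  linear_combination (invX₂ * partialX 0 f) * h1

theorem opY_opX_pow (j : ℕ) (f : Smooth) :
    opY ((opX ^ j) f) = (opX ^ j) (opY f) + (j : ℂ) • (opX ^ j) f := by
  induction j generalizing f with
  | zero => simp
  | succ j ih =>
    simp only [pow_succ, Module.End.mul_apply, ih, opY_opX, map_add, Nat.cast_succ, add_smul,
      one_smul]
    abel

/-! ### Taylor coefficients of flat sections -/

/-- The operator `(2Y + j)_k`. -/
def shiftedPochhammer (j k : ℕ) : Module.End ℂ Smooth :=
  pochhammer ((2 : ℂ) • opY + (j : ℂ) • (1 : Module.End ℂ Smooth)) k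

theorem shiftedPochhammer_zero (j : ℕ) : shiftedPochhammer j 0 = 1 := by
  simp [shiftedPochhammer, pochhammer]

theorem shiftedPochhammer_succ (j k : ℕ) : shiftedPochhammer j (k + 1) =
    ((2 : ℂ) • opY + ((j + k : ℕ) : ℂ) • 1) * shiftedPochhammer j k := by
  rw [shiftedPochhammer, pochhammer, ascPochhammer_succ_right, mul_comm, map_mul]
  congr 1
  simp only [map_add, Polynomial.aeval_X, map_natCast, Nat.cast_add, add_smul, add_assoc]
  congr 2
  ext f : 1
  simp [Nat.cast_smul_eq_nsmul]

theorem shiftedPochhammer_succ_left (j k : ℕ) : shiftedPochhammer j (k + 1) =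
    ((2 : ℂ) • opY + (j : ℂ) • 1) * shiftedPochhammer (j + 1) k := by
  rw [shiftedPochhammer, shiftedPochhammer, pochhammer, pochhammer, ascPochhammer_succ_left, map_mul,
    Polynomial.aeval_X, Polynomial.aeval_comp]
  congr 3
  simp only [map_add, Polynomial.aeval_X, map_one, Nat.cast_add, add_smul, add_assoc]
  simp

/-- The two expansions of `(2Y + j)_{k+1}` combined. -/
theorem shiftedPochhammer_sub (j k : ℕ) (f : Smooth) :
    shiftedPochhammer j (k + 1) f = shiftedPochhammer (j + 1) (k + 1) f
      - ((k + 1 : ℕ) : ℂ) • shiftedPochhammer (j + 1) k f := by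
  rw [shiftedPochhammer_succ_left, shiftedPochhammer_succ (j + 1)]
  simp only [Module.End.mul_apply, LinearMap.add_apply, LinearMap.smul_apply,
    Module.End.one_apply]
  push_cast
  module

/-- The value at `y = 0` of `(∂/∂y¹)^j (∂/∂y²)^k a` for the flat section `a` with `σ(a) = f`,
namely `(-1/2)^k x₂^{j-k} X^j (2Y + j)_k f`. -/
def flatJet (j k : ℕ) (f : Smooth) : Smooth :=
  ((-1 / 2 : ℂ) ^ k) • (x₂ ^ j * invX₂ ^ k * (opX ^ j) (shiftedPochhammer j k f))

theorem flatJet_zero (f : Smooth) : flatJet 0 0 f = f := by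
  simp [flatJet, shiftedPochhammer_zero]

theorem partialX_zero_mul_pow (j k : ℕ) (g : Smooth) :
    partialX 0 (x₂ ^ j * invX₂ ^ k * g) = x₂ ^ j * invX₂ ^ k * (x₂ * opX g) := by
  rw [partialX_mul, partialX_mul, partialX_zero_pow_x₂, partialX_zero_pow_invX₂,
    partialX_zero_eq]
  simp

theorem partialX_zero_flatJet_zero (j : ℕ) (f : Smooth) :
    partialX 0 (flatJet j 0 f) = flatJet (j + 1) 0 f := by
  rw [flatJet, flatJet, map_smul, partialX_zero_mul_pow, pow_succ' opX, shiftedPochhammer_zero,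
    shiftedPochhammer_zero, Module.End.mul_apply]
  congr 1
  ring

theorem partialX_zero_flatJet_succ (j k : ℕ) (f : Smooth) :
    partialX 0 (flatJet j (k + 1) f) =
      flatJet (j + 1) (k + 1) f + (((k + 1 : ℕ) : ℂ) / 2) • (invX₂ * flatJet (j + 1) k f) := by
  rw [flatJet, flatJet, flatJet, map_smul, partialX_zero_mul_pow, pow_succ' opX,
    shiftedPochhammer_sub, map_sub, map_sub, Module.End.mul_apply, Module.End.mul_apply, map_smul,
    map_smul]
  simp only [Algebra.smul_def, map_pow, map_natCast]
  set c : Smooth := algebraMap ℂ Smooth (-1 / 2) with hc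
  have h2 : algebraMap ℂ Smooth (((k + 1 : ℕ) : ℂ) / 2) = -c * ((k + 1 : ℕ) : Smooth) := by
    rw [hc, ← map_neg, ← map_natCast (algebraMap ℂ Smooth), ← map_mul]
    congr 1; ring
  rw [h2]
  ring

theorem partialX_one_flatJet (j k : ℕ) (f : Smooth) :
    partialX 1 (flatJet j k f) =
      flatJet j (k + 1) f + (((j : ℂ) - k) / 2) • (invX₂ * flatJet j k f) := by
  have h : (opX ^ j) (shiftedPochhammer j (k + 1) f) =
      (2 : ℂ) • (opY ((opX ^ j) (shiftedPochhammer j k f)))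
        + ((k : ℂ) - j) • (opX ^ j) (shiftedPochhammer j k f) := by
    rw [shiftedPochhammer_succ, opY_opX_pow]
    simp only [Module.End.mul_apply, LinearMap.add_apply, LinearMap.smul_apply,
      Module.End.one_apply, map_add, map_smul]
    push_cast
    module
  rw [flatJet, flatJet, h, map_smul, partialX_mul, partialX_mul, partialX_one_pow_x₂,
    partialX_one_pow_invX₂, partialX_one_eq, mul_smul_comm ((-1 / 2 : ℂ) ^ k) invX₂,
    smul_smul]
  simp only [Algebra.smul_def, map_natCast]
  set c : Smooth := algebraMap ℂ Smooth ((-1 / 2) ^ k) with hc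
  set g := (opX ^ j) (shiftedPochhammer j k f)
  have e1 : algebraMap ℂ Smooth ((-1 / 2) ^ (k + 1)) = -algebraMap ℂ Smooth (1 / 2) * c := by
    rw [hc, ← map_neg, ← map_mul]; congr 1; ring
  have e2 : algebraMap ℂ Smooth (((j : ℂ) - k) / 2 * (-1 / 2) ^ k) =
      algebraMap ℂ Smooth (1 / 2) * ((j : Smooth) - k) * c := by
    rw [hc, ← map_natCast (algebraMap ℂ Smooth), ← map_natCast (algebraMap ℂ Smooth), ← map_sub,
      ← map_mul, ← map_mul]; congr 1; ring
  have e3 : algebraMap ℂ Smooth ((k : ℂ) - j) = (k : Smooth) - j := by simp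
  have e4 : algebraMap ℂ Smooth 2 = 2 := map_ofNat _ 2
  have e5 : algebraMap ℂ Smooth (1 / 2) * 2 = 1 := by
    rw [← e4, ← map_mul]; norm_num
  rw [e1, e2, e3, e4]
  linear_combination (c * invX₂ ^ (k + 1) * x₂ ^ j * (opY g + (k - j) * g)) * e5

/-! ### The bidifferential operators of the fibrewise product -/

/-- A single fibre of the Weyl bundle without `ħ`: formal power series in `y¹, y²` with smooth
coefficients. -/
abbrev Fibre : Type := MvPowerSeries (Fin 2) Smooth

/-- `∂/∂y^k` as a derivation of the fibrewise power series. -/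
abbrev dY (k : Fin 2) : Derivation Smooth Fibre Fibre := MvPowerSeries.pderiv Smooth k

theorem dY_comm (i j : Fin 2) (φ : Fibre) : dY i (dY j φ) = dY j (dY i φ) := by
  ext1 α
  simp only [MvPowerSeries.coeff_pderiv, Finsupp.add_apply]
  rw [add_right_comm]
  by_cases h : i = j
  · rw [h]
  · simp [h, Ne.symm h]
    ring

/-- The `m`-th bidifferential operator
`ω^{i₁j₁} ⋯ ω^{i_m j_m} ∂^m φ/∂y^{i₁}⋯∂y^{i_m} ∂^m ψ/∂y^{j₁}⋯∂y^{j_m}`. -/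
def bidiff (m : ℕ) (φ ψ : Fibre) : Fibre :=
  ∑ i : Fin m → Fin 2, ∑ j : Fin m → Fin 2, (∏ s, omegaInv (i s) (j s)) •
    (iterPartialY i φ * iterPartialY j ψ)

theorem bidiff_zero (φ ψ : Fibre) : bidiff 0 φ ψ = φ * ψ := by
  simp [bidiff, iterPartialY]

theorem iterPartialY_snoc {m : ℕ} (i : Fin m → Fin 2) (k : Fin 2) (φ : Fibre) :
    iterPartialY (Fin.snoc i k : Fin (m + 1) → Fin 2) φ = iterPartialY i (dY k φ) := by
  rw [iterPartialY, List.ofFn_succ', List.concat_eq_append, List.foldr_append]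
  simp [iterPartialY]

theorem sum_snoc {M : Type*} [AddCommMonoid M] {m : ℕ} (F : (Fin (m + 1) → Fin 2) → M) :
    ∑ i, F i = ∑ k : Fin 2, ∑ i : Fin m → Fin 2, F (Fin.snoc i k) := by
  rw [← (Fin.snocEquiv fun _ => Fin 2).sum_comp, Fintype.sum_prod_type]
  rfl

theorem bidiff_succ (m : ℕ) (φ ψ : Fibre) :
    bidiff (m + 1) φ ψ = bidiff m (dY 1 φ) (dY 0 ψ) - bidiff m (dY 0 φ) (dY 1 ψ) := by
  have h (k l : Fin 2) : ∑ i : Fin m → Fin 2, ∑ j : Fin m → Fin 2,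
      (∏ s, omegaInv ((Fin.snoc i k : Fin (m + 1) → Fin 2) s)
        ((Fin.snoc j l : Fin (m + 1) → Fin 2) s)) •
        (iterPartialY (Fin.snoc i k : Fin (m + 1) → Fin 2) φ *
          iterPartialY (Fin.snoc j l : Fin (m + 1) → Fin 2) ψ) =
      omegaInv k l • bidiff m (dY k φ) (dY l ψ) := by
    simp only [bidiff, Finset.smul_sum, smul_smul, Fin.prod_univ_castSucc, Fin.snoc_castSucc,
      Fin.snoc_last, iterPartialY_snoc]
    simp only [mul_comm]
  rw [bidiff, sum_snoc]
  simp only [sum_snoc (m := m), Finset.sum_comm (s := Finset.univ (α := Fin m → Fin 2))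
    (t := Finset.univ (α := Fin 2)), h]
  simp [omegaInv]
  abel

theorem bidiff_add_left (m : ℕ) (φ φ' ψ : Fibre) :
    bidiff m (φ + φ') ψ = bidiff m φ ψ + bidiff m φ' ψ := by
  induction m generalizing φ φ' ψ with
  | zero => simp only [bidiff_zero, add_mul]
  | succ m ih => simp only [bidiff_succ, map_add, ih]; abel

theorem bidiff_zero_left (m : ℕ) (ψ : Fibre) : bidiff m 0 ψ = 0 := by
  simpa using bidiff_add_left m 0 0 ψ

/-- Exchanging the arguments produces the sign `(-1)^m`, as `ω^{ij}` is antisymmetric. -/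
theorem bidiff_swap (m : ℕ) (φ ψ : Fibre) : bidiff m ψ φ = (-1 : ℂ) ^ m • bidiff m φ ψ := by
  induction m generalizing φ ψ with
  | zero => simp [bidiff_zero, mul_comm]
  | succ m ih =>
    rw [bidiff_succ, bidiff_succ, ih (dY 0 φ), ih (dY 1 φ), pow_succ, mul_neg_one, neg_smul,
      smul_sub, neg_sub]

theorem bidiff_add_right (m : ℕ) (φ ψ ψ' : Fibre) :
    bidiff m φ (ψ + ψ') = bidiff m φ ψ + bidiff m φ ψ' := by
  rw [bidiff_swap m (ψ + ψ'), bidiff_add_left, smul_add, ← bidiff_swap, ← bidiff_swap]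

/-- The operators of order at least three vanish on a first argument that is at most quadratic
in `y`. -/
theorem bidiff_eq_zero_of_quadratic {φ : Fibre} (h : ∀ i j k, dY i (dY j (dY k φ)) = 0) (m : ℕ)
    (ψ : Fibre) : bidiff (m + 3) φ ψ = 0 := by
  simp [bidiff_succ, h, bidiff_zero_left]

open TensorProduct in
/-- Binomial expansion: a sequence of bilinear operations that starts with the product and is
generated by the difference of the commuting operators `q ⊗ p` and `p ⊗ q`. -/
theorem binomial_bidifferential {R A : Type*} [CommRing R] [CommRing A] [Algebra R A]
    (p q : Module.End R A) (hpq : Commute p q) (b : ℕ → A → A → A) (h0 : ∀ x y, b 0 x y = x * y)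
    (hs : ∀ m x y, b (m + 1) x y = b m (q x) (p y) - b m (p x) (q y)) (m : ℕ) (x y : A) :
    b m x y = ∑ k ∈ Finset.range (m + 1), (-1) ^ k * (m.choose k : A) *
      (((p ^ k) ((q ^ (m - k)) x)) * ((p ^ (m - k)) ((q ^ k) y))) := by
  let P : Module.End R (A ⊗[R] A) := TensorProduct.map (-p) q
  let Q : Module.End R (A ⊗[R] A) := TensorProduct.map q p
  have hPQ : Commute P Q := by
    change _ * _ = _ * _
    rw [← TensorProduct.map_mul, ← TensorProduct.map_mul, hpq.neg_left.eq, hpq.eq]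
  have key : ∀ x y, b m x y = LinearMap.mul' R A (((P + Q) ^ m) (x ⊗ₜ y)) := by
    induction m with
    | zero => intro x y; simp [h0]
    | succ m ih =>
      intro x y
      rw [hs, ih, ih, pow_succ, Module.End.mul_apply, ← map_sub, ← map_sub]
      congr 2
      simp only [P, Q, LinearMap.add_apply, LinearMap.neg_apply, TensorProduct.map_tmul,
        TensorProduct.neg_tmul]
      rw [neg_add_eq_sub]
  have hneg (k : ℕ) (z : A) : ((-p) ^ k) z = (-1) ^ k * (p ^ k) z := by
    induction k with
    | zero => simp
    | succ k ih =>
      rw [pow_succ', Module.End.mul_apply, ih, pow_succ' p, Module.End.mul_apply,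
        LinearMap.neg_apply]
      rcases k.even_or_odd with h | h <;> simp [h.neg_one_pow, pow_succ]
  have hc (k l : ℕ) (z : A) : (q ^ k) ((p ^ l) z) = (p ^ l) ((q ^ k) z) :=
    (LinearMap.congr_fun (hpq.pow_pow l k).eq z).symm
  rw [key, hPQ.add_pow, LinearMap.sum_apply, map_sum]
  refine Finset.sum_congr rfl fun k hk => ?_
  rw [TensorProduct.map_pow, TensorProduct.map_pow, ← nsmul_eq_mul', LinearMap.smul_apply,
    map_nsmul, Module.End.mul_apply, TensorProduct.map_tmul, TensorProduct.map_tmul,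
    LinearMap.mul'_apply, hneg, hc, nsmul_eq_mul]
  ring

theorem bidiff_eq_sum (m : ℕ) (φ ψ : Fibre) :
    bidiff m φ ψ = ∑ k ∈ Finset.range (m + 1), (-1) ^ k * (m.choose k : Fibre) *
      (((dY 0)^[k] ((dY 1)^[m - k] φ)) * ((dY 0)^[m - k] ((dY 1)^[k] ψ))) := by
  rw [binomial_bidifferential (dY 0).toLinearMap (dY 1).toLinearMap
    (LinearMap.ext fun φ => dY_comm 0 1 φ) bidiff bidiff_zero bidiff_succ]
  simp only [Module.End.pow_apply]
  rfl

/-! ### The fibrewise product and its bracket -/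

/-- The numerical coefficient of `ħ^m` in the fibrewise product. -/
def weylCoeff (m : ℕ) : ℂ := (-Complex.I / 2) ^ m / (m.factorial : ℂ)

theorem coeff_weylMul (n : ℕ) (a b : Weyl) : PowerSeries.coeff n (weylMul a b) =
    ∑ m ∈ Finset.range (n + 1), ∑ p ∈ Finset.HasAntidiagonal.antidiagonal (n - m),
      weylCoeff m • bidiff m (PowerSeries.coeff p.1 a) (PowerSeries.coeff p.2 b) :=
  PowerSeries.coeff_mk _ _

theorem weylMul_add_left (a a' b : Weyl) : weylMul (a + a') b = weylMul a b + weylMul a' b := by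
  ext1 n
  simp only [coeff_weylMul, map_add, bidiff_add_left, smul_add, Finset.sum_add_distrib]

theorem weylMul_add_right (a b b' : Weyl) : weylMul a (b + b') = weylMul a b + weylMul a b' := by
  ext1 n
  simp only [coeff_weylMul, map_add, bidiff_add_right, smul_add, Finset.sum_add_distrib]

theorem coeff_iBracket (n : ℕ) (a b : Weyl) : PowerSeries.coeff n (iBracket a b) =
    Complex.I • PowerSeries.coeff (n + 1) (weylMul a b - weylMul b a) :=
  PowerSeries.coeff_mk _ _

theorem iBracket_swap (a b : Weyl) : iBracket a b = -iBracket b a := by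
  ext1 n
  rw [map_neg, coeff_iBracket, coeff_iBracket, ← smul_neg, ← map_neg, neg_sub]

theorem iBracket_add_left (a a' b : Weyl) :
    iBracket (a + a') b = iBracket a b + iBracket a' b := by
  ext1 n
  rw [map_add, coeff_iBracket, coeff_iBracket, coeff_iBracket, ← smul_add, ← map_add,
    weylMul_add_left, weylMul_add_right, add_sub_add_comm]

theorem iBracket_add_right (a b b' : Weyl) :
    iBracket a (b + b') = iBracket a b + iBracket a b' := by
  rw [iBracket_swap, iBracket_add_left, neg_add, ← iBracket_swap, ← iBracket_swap]

theorem iBracket_zero_left (b : Weyl) : iBracket 0 b = 0 := by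
  simpa using iBracket_add_left 0 0 b

theorem coeff_weylMul_C_left (n : ℕ) (φ : Fibre) (b : Weyl) :
    PowerSeries.coeff n (weylMul (PowerSeries.C φ) b) =
      ∑ m ∈ Finset.range (n + 1), weylCoeff m • bidiff m φ (PowerSeries.coeff (n - m) b) := by
  rw [coeff_weylMul]
  refine Finset.sum_congr rfl fun m _ => ?_
  rw [Finset.sum_eq_single (0, n - m)]
  · simp
  · rintro ⟨i, j⟩ hp hne
    have hi : i ≠ 0 := by
      rintro rfl
      simp only [Finset.HasAntidiagonal.mem_antidiagonal, zero_add] at hp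
      exact hne (by rw [hp])
    rw [PowerSeries.coeff_C, if_neg hi, bidiff_zero_left, smul_zero]
  · intro h
    simp [Finset.HasAntidiagonal.mem_antidiagonal] at h

theorem coeff_weylMul_C_right (n : ℕ) (φ : Fibre) (b : Weyl) :
    PowerSeries.coeff n (weylMul b (PowerSeries.C φ)) = ∑ m ∈ Finset.range (n + 1),
      weylCoeff m • (-1 : ℂ) ^ m • bidiff m φ (PowerSeries.coeff (n - m) b) := by
  rw [coeff_weylMul]
  refine Finset.sum_congr rfl fun m _ => ?_
  rw [Finset.sum_eq_single (n - m, 0)]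
  · simp [bidiff_swap m φ]
  · rintro ⟨i, j⟩ hp hne
    have hj : j ≠ 0 := by
      rintro rfl
      simp only [Finset.HasAntidiagonal.mem_antidiagonal, add_zero] at hp
      exact hne (by rw [hp])
    rw [PowerSeries.coeff_C, if_neg hj, bidiff_swap, bidiff_zero_left, smul_zero, smul_zero]
  · intro h
    simp [Finset.HasAntidiagonal.mem_antidiagonal] at h

/-- For an `ħ`-free argument that is at most quadratic in `y` the bracket `(i/ħ)[φ, ·]` is the
fibrewise Poisson bracket. -/
theorem coeff_iBracket_C {φ : Fibre} (h : ∀ i j k, dY i (dY j (dY k φ)) = 0) (n : ℕ) (b : Weyl) :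
    PowerSeries.coeff n (iBracket (PowerSeries.C φ) b) = bidiff 1 φ (PowerSeries.coeff n b) := by
  rw [coeff_iBracket, map_sub, coeff_weylMul_C_left, coeff_weylMul_C_right,
    ← Finset.sum_sub_distrib, Finset.sum_eq_single 1]
  · rw [← smul_sub, pow_one, neg_one_smul, sub_neg_eq_add, Nat.add_sub_cancel, ← two_smul ℂ,
      smul_smul, smul_smul]
    have hI : Complex.I * weylCoeff 1 * 2 = 1 := by
      simp [weylCoeff]
      linear_combination -Complex.I_mul_I
    rw [hI, one_smul]
  · -- The terms of even order are symmetric, those of order at least three vanish.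
    intro m _ hm
    obtain rfl | rfl | ⟨l, rfl⟩ : m = 0 ∨ m = 2 ∨ ∃ l, m = l + 3 := by
      rcases m with _ | _ | _ | l
      · simp
      · simp at hm
      · simp
      · exact Or.inr (Or.inr ⟨l, rfl⟩)
    · simp
    · simp
    · simp [bidiff_eq_zero_of_quadratic h]
  · intro hm
    simp at hm

theorem iBracket_C_C {φ : Fibre} (h : ∀ i j k, dY i (dY j (dY k φ)) = 0) (ψ : Fibre) :
    iBracket (PowerSeries.C φ) (PowerSeries.C ψ) = PowerSeries.C (bidiff 1 φ ψ) := by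
  ext1 n
  rw [coeff_iBracket_C h, PowerSeries.coeff_C, PowerSeries.coeff_C]
  split_ifs
  · rfl
  · rw [bidiff_swap, bidiff_zero_left, smul_zero]

theorem bidiff_one (φ ψ : Fibre) :
    bidiff 1 φ ψ = dY 1 φ * dY 0 ψ - dY 0 φ * dY 1 ψ := by
  rw [bidiff_succ, bidiff_zero, bidiff_zero]

/-! ### The flat Fedosov connection -/

/-- The coefficientwise derivative `∂/∂x_k` of fibrewise power series. -/
def dXFibre (k : Fin 2) (φ : Fibre) : Fibre := fun α => partialX k (MvPowerSeries.coeff α φ)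

theorem coeff_dXFibre (k : Fin 2) (φ : Fibre) (α : Fin 2 →₀ ℕ) :
    MvPowerSeries.coeff α (dXFibre k φ) = partialX k (MvPowerSeries.coeff α φ) := rfl

theorem coeff_dX (k : Fin 2) (a : Weyl) (n : ℕ) :
    PowerSeries.coeff n (dX k a) = dXFibre k (PowerSeries.coeff n a) :=
  PowerSeries.coeff_mk _ _

theorem coeff_partialY (k : Fin 2) (a : Weyl) (n : ℕ) :
    PowerSeries.coeff n (partialY k a) = dY k (PowerSeries.coeff n a) :=
  PowerSeries.coeff_mk _ _

theorem dXFibre_add (k : Fin 2) (φ ψ : Fibre) :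
    dXFibre k (φ + ψ) = dXFibre k φ + dXFibre k ψ := by
  ext1 α
  simp only [coeff_dXFibre, map_add]

theorem dXFibre_neg (k : Fin 2) (φ : Fibre) : dXFibre k (-φ) = -dXFibre k φ := by
  ext1 α
  simp only [coeff_dXFibre, map_neg]

theorem dXFibre_mul (k : Fin 2) (φ ψ : Fibre) :
    dXFibre k (φ * ψ) = φ * dXFibre k ψ + ψ * dXFibre k φ := by
  classical
  ext1 α
  rw [mul_comm ψ, map_add, coeff_dXFibre]
  simp only [MvPowerSeries.coeff_mul, map_sum, partialX_mul, coeff_dXFibre,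
    Finset.sum_add_distrib]
  simp only [mul_comm]

theorem dXFibre_C (k : Fin 2) (f : Smooth) :
    dXFibre k (MvPowerSeries.C f) = MvPowerSeries.C (partialX k f) := by
  classical
  ext1 α
  rw [coeff_dXFibre, MvPowerSeries.coeff_C, MvPowerSeries.coeff_C]
  split_ifs
  · rfl
  · rw [map_zero]

theorem dXFibre_X (k i : Fin 2) : dXFibre k (MvPowerSeries.X i) = 0 := by
  classical
  ext1 α
  rw [coeff_dXFibre, MvPowerSeries.coeff_X, map_zero]
  split_ifs
  · rw [partialX_one]
  · rw [map_zero]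

theorem dXFibre_comm (i j : Fin 2) (φ : Fibre) :
    dXFibre i (dXFibre j φ) = dXFibre j (dXFibre i φ) := by
  ext1 α
  simp only [coeff_dXFibre, partialX_comm i j]

theorem dXFibre_two (k : Fin 2) : dXFibre k 2 = 0 := by
  rw [← map_ofNat (MvPowerSeries.C (σ := Fin 2) (R := Smooth)) 2, dXFibre_C,
    ← map_ofNat (algebraMap ℂ Smooth) 2, partialX_algebraMap, map_zero]

theorem dY_X (i j : Fin 2) :
    dY i (MvPowerSeries.X j) = if i = j then 1 else 0 := by
  split_ifs with h
  · rw [h]; exact MvPowerSeries.pderiv_X_self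
  · exact MvPowerSeries.pderiv_X_of_ne (Ne.symm h)

theorem dY_C (i : Fin 2) (f : Smooth) : dY i (MvPowerSeries.C f) = 0 := MvPowerSeries.pderiv_C

theorem dY_mul (i : Fin 2) (φ ψ : Fibre) : dY i (φ * ψ) = φ * dY i ψ + ψ * dY i φ :=
  (dY i).leibniz φ ψ

theorem dY_two (i : Fin 2) : dY i 2 = 0 := by
  rw [← map_ofNat (MvPowerSeries.C (σ := Fin 2) (R := Smooth)) 2, dY_C]

theorem dY_dXFibre (i j : Fin 2) (φ : Fibre) :
    dY i (dXFibre j φ) = dXFibre j (dY i φ) := by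
  ext1 α
  have h : partialX j (α i + 1 : Smooth) = 0 := by
    simpa using partialX_algebraMap j (α i + 1 : ℂ)
  simp only [coeff_dXFibre, MvPowerSeries.coeff_pderiv, partialX_mul, h]
  ring

/-- The function `1 / (4 x₂)`. -/
def quarterInv : Smooth := (1 / 4 : ℂ) • invX₂

theorem four_mul_quarterInv : 4 * quarterInv = invX₂ := by
  have h4 : (4 : Smooth) = algebraMap ℂ Smooth 4 := (map_ofNat _ 4).symm
  rw [quarterInv, h4, ← Algebra.smul_def, smul_smul]
  norm_num

theorem half_smul_invX₂ : (1 / 2 : ℂ) • invX₂ = 2 * quarterInv := by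
  have h2 : (2 : Smooth) = algebraMap ℂ Smooth 2 := (map_ofNat _ 2).symm
  rw [quarterInv, h2, ← Algebra.smul_def, smul_smul]
  norm_num

theorem partialX_quarterInv (k : Fin 2) :
    partialX k quarterInv = if k = 1 then -(4 * quarterInv * quarterInv) else 0 := by
  rw [four_mul_quarterInv, quarterInv, map_smul, partialX_invX₂]
  split_ifs
  · rw [smul_neg, mul_smul_comm]
  · rw [smul_zero]

/-- The `dx_k` component of `Γ = ½ ∑ Γ_{ijk} y^i y^j dx_k` for the flat connection: in components
`-(y²)² / (4 x₂)` and `-y¹ y² / (2 x₂)`. -/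
def flatGamma : Fin 2 → Fibre :=
  ![-(MvPowerSeries.C quarterInv * (MvPowerSeries.X 1 * MvPowerSeries.X 1)),
    -(2 * MvPowerSeries.C quarterInv * (MvPowerSeries.X 0 * MvPowerSeries.X 1))]

theorem gammaForm_flat (k : Fin 2) :
    gammaForm flatConnection k = PowerSeries.C (flatGamma k) := by
  have e (v w : Weyl) : (2 : ℂ)⁻¹ • (-(2 * v) * w) = -(v * w) := by
    have h : -(2 * v) * w = -(v * w) + -(v * w) := by ring
    rw [h, ← two_smul ℂ, smul_smul]
    norm_num
  have h2 : (PowerSeries.C (MvPowerSeries.C 2) : Weyl) = 2 := by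
    rw [map_ofNat, map_ofNat]
  have h2' : (PowerSeries.C 2 : Weyl) = 2 := map_ofNat _ 2
  have hq : (2 : ℂ)⁻¹ • invX₂ = 2 * quarterInv := by rw [← half_smul_invX₂, one_div]
  fin_cases k
  · simp only [gammaForm, christoffelLower, flatConnection, omega, flatGamma, ofSmooth, yVar]
    simp [hq, h2]
    rw [e]
  · simp only [gammaForm, christoffelLower, flatConnection, omega, flatGamma, ofSmooth, yVar]
    simp [hq, h2, h2']
    rw [e, e]
    ring

/-- The `dx_k` component of the connection form `ω_{ij} y^i dx_j + Γ` of the flat connection. -/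
def flatForm : Fin 2 → Fibre :=
  ![-MvPowerSeries.X 1 + flatGamma 0, MvPowerSeries.X 0 + flatGamma 1]

theorem flatGamma_quadratic (l i j k : Fin 2) : dY i (dY j (dY k (flatGamma l))) = 0 := by
  fin_cases l <;>
  simp only [flatGamma, Fin.zero_eta, Fin.mk_one, Matrix.cons_val_zero, Matrix.cons_val_one,
      map_neg, dY_mul, dY_C, dY_two, dY_X] <;>
    split_ifs <;> simp [dY_X, dY_two] <;> split_ifs <;> simp [dY_two]

theorem flatForm_quadratic (l i j k : Fin 2) : dY i (dY j (dY k (flatForm l))) = 0 := by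
  fin_cases l <;>
  simp only [flatForm, Fin.zero_eta, Fin.mk_one, Matrix.cons_val_zero, Matrix.cons_val_one,
      map_add, map_neg, flatGamma_quadratic, dY_X] <;> split_ifs <;> simp

/-- The component of the Fedosov connection `-δ + d + (i/ħ)[Γ, ·]` in the direction `dx_k`,
acting on fibrewise power series. -/
def flatD (k : Fin 2) (φ : Fibre) : Fibre := -dY k φ + (dXFibre k φ + bidiff 1 (flatGamma k) φ)

theorem flatD_zero_eq (φ : Fibre) : flatD 0 φ = -dY 0 φ + dXFibre 0 φ
    - 2 * MvPowerSeries.C quarterInv * MvPowerSeries.X 1 * dY 0 φ := by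
  simp [flatD, bidiff_one, flatGamma]
  ring

theorem flatD_one_eq (φ : Fibre) : flatD 1 φ = -dY 1 φ + dXFibre 1 φ
    - 2 * MvPowerSeries.C quarterInv * MvPowerSeries.X 0 * dY 0 φ
    + 2 * MvPowerSeries.C quarterInv * MvPowerSeries.X 1 * dY 1 φ := by
  simp [flatD, bidiff_one, flatGamma, dY_two]
  ring

/-- The curvature of the flat connection vanishes, so the Fedosov connection with `r = 0` is
abelian. -/
theorem flatD_comm (φ : Fibre) : flatD 0 (flatD 1 φ) = flatD 1 (flatD 0 φ) := by
  have h4 : (MvPowerSeries.C 4 : Fibre) = 4 := map_ofNat _ 4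
  simp only [flatD_zero_eq, flatD_one_eq, sub_eq_add_neg, map_add, map_neg, dXFibre_add,
    dXFibre_neg, dXFibre_mul, dY_mul, dXFibre_C, dY_C, dXFibre_X, dY_X, partialX_quarterInv,
    dY_two, dXFibre_two, dY_dXFibre, dY_comm 1 0, dXFibre_comm 1 0]
  simp [h4]
  ring

theorem coeff_fedosovD_flat (k : Fin 2) (a : Weyl) (n : ℕ) :
    PowerSeries.coeff n (fedosovD flatConnection 0 k a) = flatD k (PowerSeries.coeff n a) := by
  rw [fedosovD, gammaForm_flat, Pi.zero_apply, iBracket_zero_left, add_zero, map_add, map_add,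
    map_neg, coeff_partialY, coeff_dX, coeff_iBracket_C (flatGamma_quadratic k), flatD]

theorem connectionForm_flat (k : Fin 2) :
    connectionForm flatConnection 0 k = PowerSeries.C (flatForm k) := by
  rw [connectionForm, gammaForm_flat]
  fin_cases k <;> simp [flatForm, omega, yVar]

theorem connectionForm_eq_add (r : Fin 2 → Weyl) (k : Fin 2) :
    connectionForm flatConnection r k = PowerSeries.C (flatForm k) + r k := by
  rw [← connectionForm_flat, connectionForm, connectionForm, Pi.zero_apply, add_zero]

theorem iBracket_flatForm (k : Fin 2) (a : Weyl) :
    dX k a + iBracket (PowerSeries.C (flatForm k)) a = fedosovD flatConnection 0 k a := by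
  ext1 n
  rw [coeff_fedosovD_flat, map_add, coeff_dX, coeff_iBracket_C (flatForm_quadratic k), flatD]
  have h : bidiff 1 (flatForm k) (PowerSeries.coeff n a) =
      -dY k (PowerSeries.coeff n a) + bidiff 1 (flatGamma k) (PowerSeries.coeff n a) := by
    fin_cases k <;> simp [flatForm, bidiff_add_left] <;> simp [bidiff_one]
    ring
  rw [h]
  ring

theorem dX_add (k : Fin 2) (a b : Weyl) : dX k (a + b) = dX k a + dX k b := by
  ext1 n
  simp only [map_add, coeff_dX, dXFibre_add]

/-- The dependence of the Weyl curvature on the correction `r` of the flat connection form. -/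
theorem weylCurvature_flat (r : Fin 2 → Weyl) : weylCurvature flatConnection r =
    weylCurvature flatConnection 0 + (fedosovD flatConnection 0 0 (r 1)
      - fedosovD flatConnection 0 1 (r 0) + iBracket (r 0) (r 1)) := by
  rw [← iBracket_flatForm, ← iBracket_flatForm, weylCurvature, weylCurvature]
  simp only [connectionForm_eq_add, Pi.zero_apply, add_zero, dX_add, iBracket_add_left,
    iBracket_add_right]
  rw [iBracket_swap (r 0) (PowerSeries.C (flatForm 1))]
  abel

/-- The only surviving contribution is the Poisson bracket `{-y², y¹} = -1` of the linear terms. -/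
theorem weylCurvature_flat_zero :
    weylCurvature flatConnection 0 = central (-omegaForm) := by
  have hC (k : Fin 2) (φ : Fibre) : dX k (PowerSeries.C φ) = PowerSeries.C (dXFibre k φ) := by
    ext1 n
    rw [coeff_dX, PowerSeries.coeff_C, PowerSeries.coeff_C]
    split_ifs
    · rfl
    · simpa using dXFibre_C k 0
  rw [weylCurvature]
  simp only [connectionForm_flat, hC, iBracket_C_C (flatForm_quadratic 0), ← map_sub, ← map_add]
  have h1 : central (-omegaForm) = PowerSeries.C (-1) := by
    simp [central, omegaForm, omega]
  rw [h1]
  congr 1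
  have h4 : (MvPowerSeries.C 4 : Fibre) = 4 := map_ofNat _ 4
  simp [flatForm, flatGamma, bidiff_one, dY_two, dXFibre_add, dXFibre_neg, dXFibre_mul,
    dXFibre_C, dXFibre_X, dXFibre_two, partialX_quarterInv, h4]
  ring

theorem isFedosovForm_zero : IsFedosovForm flatConnection (-omegaForm) 0 where
  curvature := weylCurvature_flat_zero
  abelian a := by
    rw [fedosovD₁, sub_eq_zero]
    ext1 n
    simp only [coeff_fedosovD_flat, flatD_comm]
  degree := by simp
  normalised := by simp

/-! ### Uniqueness of the Fedosov form -/

/-- A section of the Weyl bundle has degree at least `N`, where `deg y^k = 1` and `deg ħ = 2`. -/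
def HasDegreeGE (N : ℕ) (a : Weyl) : Prop := ∀ (n : ℕ) (α : Fin 2 →₀ ℕ),
  2 * n + α.degree < N → MvPowerSeries.coeff α (PowerSeries.coeff n a) = 0

/-- A fibrewise power series has only terms of degree at least `N` in `y`. -/
def FibreDegreeGE (N : ℕ) (φ : Fibre) : Prop := ∀ α : Fin 2 →₀ ℕ,
  α.degree < N → MvPowerSeries.coeff α φ = 0

theorem FibreDegreeGE.mul {N M : ℕ} {φ ψ : Fibre} (hφ : FibreDegreeGE N φ)
    (hψ : FibreDegreeGE M ψ) : FibreDegreeGE (N + M) (φ * ψ) := by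
  classical
  intro α hα
  rw [MvPowerSeries.coeff_mul]
  refine Finset.sum_eq_zero fun p hp => ?_
  rw [Finset.HasAntidiagonal.mem_antidiagonal] at hp
  rw [← hp, map_add] at hα
  rcases lt_or_ge p.1.degree N with h | h
  · rw [hφ _ h, zero_mul]
  · rw [hψ _ (by omega), mul_zero]

theorem FibreDegreeGE.dY {N : ℕ} {φ : Fibre} (hφ : FibreDegreeGE N φ) (k : Fin 2) :
    FibreDegreeGE (N - 1) (dY k φ) := by
  intro α hα
  rw [MvPowerSeries.coeff_pderiv, hφ _ (by rw [map_add, Finsupp.degree_single]; omega), zero_mul]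

theorem FibreDegreeGE.bidiff {N M : ℕ} {φ ψ : Fibre} (hφ : FibreDegreeGE N φ)
    (hψ : FibreDegreeGE M ψ) (m : ℕ) : FibreDegreeGE ((N - m) + (M - m)) (bidiff m φ ψ) := by
  induction m generalizing N M φ ψ with
  | zero => rw [bidiff_zero]; exact hφ.mul hψ
  | succ m ih =>
    intro α hα
    rw [bidiff_succ, map_sub, ih (hφ.dY 1) (hψ.dY 0) α (by omega),
      ih (hφ.dY 0) (hψ.dY 1) α (by omega), sub_zero]

theorem HasDegreeGE.coeff {N : ℕ} {a : Weyl} (ha : HasDegreeGE N a) (n : ℕ) :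
    FibreDegreeGE (N - 2 * n) (PowerSeries.coeff n a) :=
  fun α hα => ha n α (by omega)

theorem HasDegreeGE.weylMul {N M : ℕ} {a b : Weyl} (ha : HasDegreeGE N a)
    (hb : HasDegreeGE M b) : HasDegreeGE (N + M) (weylMul a b) := by
  intro n α hα
  rw [coeff_weylMul, map_sum]
  refine Finset.sum_eq_zero fun m hm => ?_
  rw [map_sum]
  refine Finset.sum_eq_zero fun p hp => ?_
  rw [Finset.HasAntidiagonal.mem_antidiagonal] at hp
  rw [Finset.mem_range] at hm
  have h := ((ha.coeff p.1).bidiff (hb.coeff p.2) m) α (by omega)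
  rw [← algebraMap_smul Smooth (weylCoeff m), MvPowerSeries.coeff_smul, h, mul_zero]

theorem HasDegreeGE.iBracket {N M : ℕ} {a b : Weyl} (ha : HasDegreeGE N a)
    (hb : HasDegreeGE M b) : HasDegreeGE (N + M - 2) (iBracket a b) := by
  intro n α hα
  rw [coeff_iBracket, ← algebraMap_smul Smooth Complex.I, MvPowerSeries.coeff_smul, map_sub,
    map_sub, ha.weylMul hb _ _ (by omega), hb.weylMul ha _ _ (by omega), sub_zero, mul_zero]

theorem coeff_X_mul_of_eq_zero (i : Fin 2) (φ : Fibre) {α : Fin 2 →₀ ℕ} (h : α i = 0) :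
    MvPowerSeries.coeff α (MvPowerSeries.X i * φ) = 0 := by
  rw [MvPowerSeries.X_def, MvPowerSeries.coeff_monomial_mul, if_neg]
  intro hle
  have := hle i
  simp [h] at this

theorem coeff_X_mul_add_single (i : Fin 2) (φ : Fibre) (α : Fin 2 →₀ ℕ) :
    MvPowerSeries.coeff (α + Finsupp.single i 1) (MvPowerSeries.X i * φ) =
      MvPowerSeries.coeff α φ := by
  rw [MvPowerSeries.X_def, add_comm, MvPowerSeries.coeff_add_monomial_mul, one_mul]

theorem FibreDegreeGE.X_mul {N : ℕ} {φ : Fibre} (hφ : FibreDegreeGE N φ) (i : Fin 2) :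
    FibreDegreeGE (N + 1) (MvPowerSeries.X i * φ) := by
  have hX : FibreDegreeGE 1 (MvPowerSeries.X i) := by
    intro α hα
    have h0 : α = 0 := by rw [← Finsupp.degree_eq_zero_iff]; omega
    rw [h0, MvPowerSeries.coeff_zero_X]
  rw [add_comm]
  exact hX.mul hφ

/-- Up to terms of higher degree, `flatD k` is `-∂/∂y^k`. -/
theorem FibreDegreeGE.flatD_add_dY {N : ℕ} {φ : Fibre} (hφ : FibreDegreeGE N φ) (k : Fin 2) :
    FibreDegreeGE N (flatD k φ + RankinCohenFedosov.dY k φ) := by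
  intro α hα
  have hx (k : Fin 2) : MvPowerSeries.coeff α (dXFibre k φ) = 0 := by
    rw [coeff_dXFibre, hφ α hα, map_zero]
  have hy (i j : Fin 2) : MvPowerSeries.coeff α
      (MvPowerSeries.X i * RankinCohenFedosov.dY j φ) = 0 :=
    (hφ.dY j).X_mul i α (by omega)
  have h2 : (2 : Fibre) = MvPowerSeries.C 2 := (map_ofNat _ 2).symm
  fin_cases k
  · simp [flatD_zero_eq, hx, hy, h2, mul_assoc, MvPowerSeries.coeff_C_mul]
  · simp [flatD_one_eq, hx, hy, h2, mul_assoc, MvPowerSeries.coeff_C_mul]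

theorem cast_mul_eq_zero {n : ℕ} (hn : n ≠ 0) {f : Smooth} (h : (n : Smooth) * f = 0) : f = 0 := by
  rw [← map_natCast (algebraMap ℂ Smooth), ← Algebra.smul_def] at h
  exact (smul_eq_zero.1 h).resolve_left (Nat.cast_ne_zero.2 hn)

/-- Injectivity of `δ` on the kernel of `δ*`, in each degree: a `1`-form with
`y¹ φ₁ + y² φ₂ = 0` that is closed under `δ` up to order `N` vanishes up to order `N + 1`. -/
theorem fibreDegreeGE_of_closed {N : ℕ} {φ : Fin 2 → Fibre}
    (hn : MvPowerSeries.X 0 * φ 0 + MvPowerSeries.X 1 * φ 1 = 0)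
    (hd : FibreDegreeGE N (dY 0 (φ 1) - dY 1 (φ 0))) (k : Fin 2) : FibreDegreeGE (N + 1) (φ k) := by
  classical
  have hcoeff (α) := congrArg (MvPowerSeries.coeff α) hn
  simp only [map_add, map_zero] at hcoeff
  -- The hypotheses are symmetric in the two indices; `l` is the index other than `k`.
  obtain ⟨l, hl, hn', hd'⟩ : ∃ l, l ≠ k ∧
      (∀ α, MvPowerSeries.coeff α (MvPowerSeries.X k * φ k) +
        MvPowerSeries.coeff α (MvPowerSeries.X l * φ l) = 0) ∧
      FibreDegreeGE N (dY k (φ l) - dY l (φ k)) := by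
    fin_cases k
    · exact ⟨1, by decide, hcoeff, hd⟩
    · refine ⟨0, by decide, fun α => by rw [add_comm]; exact hcoeff α, fun α hα => ?_⟩
      rw [← neg_sub, map_neg]
      exact neg_eq_zero.2 (hd α hα)
  intro α hα
  by_cases h : α l = 0
  · have h1 := hn' (α + Finsupp.single k 1)
    rwa [coeff_X_mul_add_single, coeff_X_mul_of_eq_zero l _ (by simp [h, hl]), add_zero] at h1
  · obtain ⟨β, rfl⟩ : ∃ β, α = β + Finsupp.single l 1 :=
      ⟨α - Finsupp.single l 1, (tsub_add_cancel_of_le (by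
        rw [Finsupp.single_le_iff]; omega)).symm⟩
    have h1 := hn' (β + Finsupp.single l 1 + Finsupp.single k 1)
    rw [coeff_X_mul_add_single, add_right_comm, coeff_X_mul_add_single] at h1
    rw [map_add, Finsupp.degree_single] at hα
    have h2 := hd' β (by omega)
    rw [map_sub, MvPowerSeries.coeff_pderiv, MvPowerSeries.coeff_pderiv] at h2
    -- On bihomogeneous terms `δ δ* + δ* δ` is multiplication by the total degree.
    refine cast_mul_eq_zero (n := β k + β l + 2) (by omega) ?_
    push_cast
    linear_combination (β k + 1 : Smooth) * h1 - h2

/-- The correction `r = 0` is the only Fedosov form: the lowest term of `r` is killed both by `δ`,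
because of the curvature equation, and by `δ*`. -/
theorem IsFedosovForm.eq_zero {r : Fin 2 → Weyl}
    (h : IsFedosovForm flatConnection (-omegaForm) r) : r = 0 := by
  have hcurv : fedosovD flatConnection 0 0 (r 1) - fedosovD flatConnection 0 1 (r 0)
      + iBracket (r 0) (r 1) = 0 := by
    have h1 := weylCurvature_flat r
    rw [h.curvature, weylCurvature_flat_zero] at h1
    exact left_eq_add.1 h1
  have hnorm (n : ℕ) : MvPowerSeries.X 0 * PowerSeries.coeff n (r 0)
      + MvPowerSeries.X 1 * PowerSeries.coeff n (r 1) = 0 := by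
    have h1 := congrArg (PowerSeries.coeff n) h.normalised
    rwa [Fin.sum_univ_two, map_add, yVar, yVar, PowerSeries.coeff_C_mul, PowerSeries.coeff_C_mul,
      map_zero] at h1
  have key (N : ℕ) : ∀ k, HasDegreeGE (N + 3) (r k) := by
    induction N with
    | zero => exact fun k n α hα => h.degree k n α hα
    | succ N ih =>
      intro k n α hα
      refine fibreDegreeGE_of_closed (N := N + 3 - 2 * n) (φ := fun k => PowerSeries.coeff n (r k))
        (hnorm n) (fun β hβ => ?_) k α (by omega)
      -- `δ r` has terms one degree lower than all the other terms of the curvature equation.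
      have h0 := ((ih 0).coeff n).flatD_add_dY 1 β (by omega)
      have h1 := ((ih 1).coeff n).flatD_add_dY 0 β (by omega)
      have hb := (ih 0).iBracket (ih 1) n β (by omega)
      have hc := congrArg (fun a => MvPowerSeries.coeff β (PowerSeries.coeff n a)) hcurv
      simp only [map_add, map_sub, coeff_fedosovD_flat, hb, map_zero] at h0 h1 hc ⊢
      linear_combination h1 - h0 - hc
  funext k
  ext n α
  rw [key (2 * n + α.degree) k n α (by omega)]
  simp

/-! ### Flat sections -/

/-- The multi-index `(j, k)`. -/
def multiIndex (j k : ℕ) : Fin 2 →₀ ℕ := Finsupp.single 0 j + Finsupp.single 1 k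

theorem multiIndex_apply_zero (j k : ℕ) : multiIndex j k 0 = j := by simp [multiIndex]

theorem multiIndex_apply_one (j k : ℕ) : multiIndex j k 1 = k := by simp [multiIndex]

theorem eq_multiIndex (α : Fin 2 →₀ ℕ) : α = multiIndex (α 0) (α 1) := by
  ext i
  fin_cases i <;> simp [multiIndex]

theorem multiIndex_add_single_zero (j k : ℕ) :
    multiIndex j k + Finsupp.single 0 1 = multiIndex (j + 1) k := by
  rw [multiIndex, multiIndex, Finsupp.single_add, add_right_comm]

theorem multiIndex_add_single_one (j k : ℕ) :
    multiIndex j k + Finsupp.single 1 1 = multiIndex j (k + 1) := by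
  rw [multiIndex, multiIndex, Finsupp.single_add, add_assoc]

/-- The jet `(∂/∂y¹)^j (∂/∂y²)^k φ` at `y = 0`. -/
def jet (j k : ℕ) (φ : Fibre) : Smooth :=
  MvPowerSeries.constantCoeff ((dY 0)^[j] ((dY 1)^[k] φ))

theorem jet_zero (φ : Fibre) : jet 0 0 φ = MvPowerSeries.constantCoeff φ := rfl

theorem coeff_iterate_dY_one (k l m : ℕ) (φ : Fibre) :
    (l.factorial : Smooth) * MvPowerSeries.coeff (multiIndex m l) ((dY 1)^[k] φ) =
      ((l + k).factorial : Smooth) * MvPowerSeries.coeff (multiIndex m (l + k)) φ := by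
  induction k generalizing l with
  | zero => rfl
  | succ k ih =>
    rw [Function.iterate_succ_apply', MvPowerSeries.coeff_pderiv, multiIndex_apply_one,
      multiIndex_add_single_one]
    have h := ih (l + 1)
    rw [Nat.factorial_succ, add_right_comm, add_assoc] at h
    rw [← h]
    push_cast
    ring

theorem coeff_iterate_dY_zero (j l m : ℕ) (φ : Fibre) :
    (l.factorial : Smooth) * MvPowerSeries.coeff (multiIndex l m) ((dY 0)^[j] φ) =
      ((l + j).factorial : Smooth) * MvPowerSeries.coeff (multiIndex (l + j) m) φ := by
  induction j generalizing l with
  | zero => rfl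
  | succ k ih =>
    rw [Function.iterate_succ_apply', MvPowerSeries.coeff_pderiv, multiIndex_apply_zero,
      multiIndex_add_single_zero]
    have h := ih (l + 1)
    rw [Nat.factorial_succ, add_right_comm, add_assoc] at h
    rw [← h]
    push_cast
    ring

theorem jet_eq (j k : ℕ) (φ : Fibre) : jet j k φ =
    (j.factorial : Smooth) * (k.factorial : Smooth) *
      MvPowerSeries.coeff (multiIndex j k) φ := by
  have h1 := coeff_iterate_dY_zero j 0 0 ((dY 1)^[k] φ)
  have h2 := coeff_iterate_dY_one k 0 j φ
  rw [zero_add, Nat.factorial_zero, Nat.cast_one, one_mul] at h1 h2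
  rw [mul_assoc, ← h2, ← h1]
  simp [jet, multiIndex]

theorem fibre_ext_jet {φ ψ : Fibre} (h : ∀ j k, jet j k φ = jet j k ψ) : φ = ψ := by
  ext1 α
  have h1 := h (α 0) (α 1)
  rw [jet_eq, jet_eq, ← eq_multiIndex, ← sub_eq_zero, ← mul_sub, ← Nat.cast_mul] at h1
  exact sub_eq_zero.1 (cast_mul_eq_zero
    (mul_ne_zero (Nat.factorial_ne_zero _) (Nat.factorial_ne_zero _)) h1)

/-- Every doubly indexed family of functions is the family of jets of a formal power series. -/
theorem exists_jet (F : ℕ → ℕ → Smooth) : ∃ φ : Fibre, ∀ j k, jet j k φ = F j k := by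
  let φ : Fibre :=
    fun α => (((α 0).factorial : ℂ) * ((α 1).factorial : ℂ))⁻¹ • F (α 0) (α 1)
  have hφ (α : Fin 2 →₀ ℕ) : MvPowerSeries.coeff α φ =
      (((α 0).factorial : ℂ) * ((α 1).factorial : ℂ))⁻¹ • F (α 0) (α 1) := rfl
  refine ⟨φ, fun j k => ?_⟩
  rw [jet_eq, hφ, multiIndex_apply_zero, multiIndex_apply_one,
    ← map_natCast (algebraMap ℂ Smooth), ← map_natCast (algebraMap ℂ Smooth), ← map_mul,
    ← Algebra.smul_def, smul_smul, mul_inv_cancel₀, one_smul]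
  exact mul_ne_zero (Nat.cast_ne_zero.2 (Nat.factorial_ne_zero _))
    (Nat.cast_ne_zero.2 (Nat.factorial_ne_zero _))

theorem jet_add (j k : ℕ) (φ ψ : Fibre) : jet j k (φ + ψ) = jet j k φ + jet j k ψ := by
  simp only [jet_eq, map_add, mul_add]

theorem jet_neg (j k : ℕ) (φ : Fibre) : jet j k (-φ) = -jet j k φ := by
  rw [jet_eq, jet_eq, map_neg]
  ring

theorem jet_C_mul (j k : ℕ) (f : Smooth) (φ : Fibre) :
    jet j k (MvPowerSeries.C f * φ) = f * jet j k φ := by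
  simp only [jet_eq, MvPowerSeries.coeff_C_mul]
  ring

theorem jet_dXFibre (j k : ℕ) (i : Fin 2) (φ : Fibre) :
    jet j k (dXFibre i φ) = partialX i (jet j k φ) := by
  simp only [jet_eq, coeff_dXFibre]
  rw [← map_natCast (algebraMap ℂ Smooth), ← map_natCast (algebraMap ℂ Smooth), ← map_mul,
    ← Algebra.smul_def, ← Algebra.smul_def, map_smul]

theorem jet_dY_zero (j k : ℕ) (φ : Fibre) : jet j k (dY 0 φ) = jet (j + 1) k φ := by
  rw [jet_eq, jet_eq, MvPowerSeries.coeff_pderiv, multiIndex_add_single_zero,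
    multiIndex_apply_zero, Nat.factorial_succ]
  push_cast
  ring

theorem jet_dY_one (j k : ℕ) (φ : Fibre) : jet j k (dY 1 φ) = jet j (k + 1) φ := by
  rw [jet_eq, jet_eq, MvPowerSeries.coeff_pderiv, multiIndex_add_single_one,
    multiIndex_apply_one, Nat.factorial_succ]
  push_cast
  ring

theorem jet_X_zero_mul_zero (k : ℕ) (φ : Fibre) : jet 0 k (MvPowerSeries.X 0 * φ) = 0 := by
  rw [jet_eq, coeff_X_mul_of_eq_zero _ _ (multiIndex_apply_zero _ _), mul_zero]

theorem jet_X_one_mul_zero (j : ℕ) (φ : Fibre) : jet j 0 (MvPowerSeries.X 1 * φ) = 0 := by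
  rw [jet_eq, coeff_X_mul_of_eq_zero _ _ (multiIndex_apply_one _ _), mul_zero]

theorem jet_X_zero_mul_succ (j k : ℕ) (φ : Fibre) :
    jet (j + 1) k (MvPowerSeries.X 0 * φ) = (j + 1 : Smooth) * jet j k φ := by
  rw [jet_eq, jet_eq, ← multiIndex_add_single_zero, coeff_X_mul_add_single, Nat.factorial_succ]
  push_cast
  ring

theorem jet_X_one_mul_succ (j k : ℕ) (φ : Fibre) :
    jet j (k + 1) (MvPowerSeries.X 1 * φ) = (k + 1 : Smooth) * jet j k φ := by
  rw [jet_eq, jet_eq, ← multiIndex_add_single_one, coeff_X_mul_add_single, Nat.factorial_succ]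
  push_cast
  ring

/-- Euler's relation for `y¹`. -/
theorem jet_X_zero_mul_dY_zero (j k : ℕ) (φ : Fibre) :
    jet j k (MvPowerSeries.X 0 * dY 0 φ) = (j : Smooth) * jet j k φ := by
  cases j with
  | zero => simp [jet_X_zero_mul_zero]
  | succ j => rw [jet_X_zero_mul_succ, jet_dY_zero, Nat.cast_succ]

/-- Euler's relation for `y²`. -/
theorem jet_X_one_mul_dY_one (j k : ℕ) (φ : Fibre) :
    jet j k (MvPowerSeries.X 1 * dY 1 φ) = (k : Smooth) * jet j k φ := by
  cases k with
  | zero => simp [jet_X_one_mul_zero]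
  | succ k => rw [jet_X_one_mul_succ, jet_dY_one, Nat.cast_succ]

theorem C_two_mul_quarterInv :
    (2 * MvPowerSeries.C quarterInv : Fibre) = MvPowerSeries.C (2 * quarterInv) := by
  rw [map_mul, map_ofNat]

theorem jet_flatD_zero (j k : ℕ) (φ : Fibre) : jet j k (flatD 0 φ) = -jet (j + 1) k φ
    + partialX 0 (jet j k φ) - 2 * quarterInv * jet j k (MvPowerSeries.X 1 * dY 0 φ) := by
  rw [flatD_zero_eq, sub_eq_add_neg, C_two_mul_quarterInv, mul_assoc, jet_add, jet_add, jet_neg,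
    jet_neg, jet_dXFibre, jet_dY_zero, jet_C_mul, sub_eq_add_neg]

theorem jet_flatD_one (j k : ℕ) (φ : Fibre) : jet j k (flatD 1 φ) = -jet j (k + 1) φ
    + partialX 1 (jet j k φ) - 2 * quarterInv * ((j : Smooth) - k) * jet j k φ := by
  rw [flatD_one_eq, sub_eq_add_neg, C_two_mul_quarterInv, mul_assoc, mul_assoc, jet_add, jet_add,
    jet_add, jet_neg, jet_neg, jet_dXFibre, jet_dY_one, jet_C_mul, jet_C_mul,
    jet_X_zero_mul_dY_zero, jet_X_one_mul_dY_one]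
  ring

theorem div_two_smul_invX₂_mul (z : ℂ) (f : Smooth) :
    (z / 2) • (invX₂ * f) = algebraMap ℂ Smooth z * (2 * quarterInv * f) := by
  rw [← half_smul_invX₂, smul_mul_assoc, ← Algebra.smul_def, smul_smul]
  congr 1
  ring

/-- A fibrewise power series is flat exactly when its jets at `y = 0` are those prescribed by
`flatJet` in terms of its value at `y = 0`. -/
theorem flat_iff_jet (φ : Fibre) : (∀ k, flatD k φ = 0) ↔
    ∀ j k, jet j k φ = flatJet j k (MvPowerSeries.constantCoeff φ) := by
  have hz (j k) : jet j k (0 : Fibre) = 0 := by rw [jet_eq, map_zero, mul_zero]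
  constructor
  · intro h j k
    induction k with
    | zero =>
      induction j with
      | zero => rw [jet_zero, flatJet_zero]
      | succ j ih =>
        have h0 := jet_flatD_zero j 0 φ
        rw [h, hz, jet_X_one_mul_zero, ih, partialX_zero_flatJet_zero] at h0
        linear_combination h0
    | succ k ih =>
      have h1 := jet_flatD_one j k φ
      rw [h, hz, ih, partialX_one_flatJet, div_two_smul_invX₂_mul, map_sub, map_natCast,
        map_natCast] at h1
      linear_combination h1
  · intro h i
    refine fibre_ext_jet fun j k => ?_
    rw [hz]
    fin_cases i
    · change jet j k (flatD 0 φ) = 0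
      cases k with
      | zero =>
        rw [jet_flatD_zero, jet_X_one_mul_zero, h, h, partialX_zero_flatJet_zero]
        ring
      | succ k =>
        rw [jet_flatD_zero, jet_X_one_mul_succ, jet_dY_zero, h, h, h, partialX_zero_flatJet_succ,
          div_two_smul_invX₂_mul, map_natCast]
        push_cast
        ring
    · change jet j k (flatD 1 φ) = 0
      rw [jet_flatD_one, h, h, partialX_one_flatJet, div_two_smul_invX₂_mul, map_sub, map_natCast,
        map_natCast]
      ring

theorem existsUnique_flat (f : Smooth) :
    ∃! φ : Fibre, (∀ k, flatD k φ = 0) ∧ MvPowerSeries.constantCoeff φ = f := by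
  obtain ⟨φ, hφ⟩ := exists_jet fun j k => flatJet j k f
  have h0 : MvPowerSeries.constantCoeff φ = f := by rw [← jet_zero, hφ, flatJet_zero]
  refine ⟨φ, ⟨(flat_iff_jet φ).2 fun j k => by rw [hφ, h0], h0⟩, fun ψ hψ => ?_⟩
  exact fibre_ext_jet fun j k => by rw [(flat_iff_jet ψ).1 hψ.1, hψ.2, hφ]

theorem isFlatSection_flat_iff (a : Weyl) : IsFlatSection flatConnection 0 a ↔
    ∀ n k, flatD k (PowerSeries.coeff n a) = 0 := by
  constructor
  · intro h n k
    rw [← coeff_fedosovD_flat, h k, map_zero]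
  · intro h k
    ext1 n
    rw [coeff_fedosovD_flat, h, map_zero]

theorem coeff_sigma (n : ℕ) (a : Weyl) : PowerSeries.coeff n (sigma a) =
    MvPowerSeries.constantCoeff (PowerSeries.coeff n a) :=
  PowerSeries.coeff_map _ _ _

theorem existsUnique_flatSection (f : FormalFunctions) :
    ∃! a : Weyl, IsFlatSection flatConnection 0 a ∧ sigma a = f := by
  choose φ hφ huniq using fun n => existsUnique_flat (PowerSeries.coeff n f)
  refine ⟨PowerSeries.mk φ, ⟨(isFlatSection_flat_iff _).2 fun n k => ?_, ?_⟩, fun b hb => ?_⟩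
  · rw [PowerSeries.coeff_mk]
    exact (hφ n).1 k
  · ext1 n
    rw [coeff_sigma, PowerSeries.coeff_mk]
    exact (hφ n).2
  · ext1 n
    rw [PowerSeries.coeff_mk]
    refine huniq n _ ⟨(isFlatSection_flat_iff b).1 hb.1 n, ?_⟩
    rw [← coeff_sigma, hb.2]

/-! ### The star product -/

/-- The powers of `x₂` in complementary jets cancel, which leaves the terms of the Rankin–Cohen
brackets. -/
theorem flatJet_mul_flatJet (j k : ℕ) (f g : Smooth) : flatJet j k f * flatJet k j g =
    ((-1 / 2 : ℂ) ^ (k + j)) •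
      ((opX ^ j) (shiftedPochhammer j k f) * (opX ^ k) (shiftedPochhammer k j g)) := by
  have h (l : ℕ) : x₂ ^ l * invX₂ ^ l = 1 := by rw [← mul_pow, x₂_mul_invX₂, one_pow]
  simp only [flatJet, Algebra.smul_def, pow_add, map_mul]
  set u := (opX ^ j) (shiftedPochhammer j k f)
  set v := (opX ^ k) (shiftedPochhammer k j g)
  linear_combination (algebraMap ℂ Smooth ((-1 / 2) ^ k) * algebraMap ℂ Smooth ((-1 / 2) ^ j) *
    u * v) * (x₂ ^ k * invX₂ ^ k * h j + h k)

/-- At `y = 0` the `m`-th term of the fibrewise product of two flat sections is a multiple of the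
`m`-th Rankin–Cohen bracket. -/
theorem constantCoeff_bidiff {φ ψ : Fibre} (hφ : ∀ k, flatD k φ = 0) (hψ : ∀ k, flatD k ψ = 0)
    (m : ℕ) : MvPowerSeries.constantCoeff (weylCoeff m • bidiff m φ ψ) =
      (Complex.I / 4) ^ m • rankinCohen m (MvPowerSeries.constantCoeff φ)
        (MvPowerSeries.constantCoeff ψ) := by
  rw [← algebraMap_smul Smooth (weylCoeff m), MvPowerSeries.smul_eq_C_mul, map_mul,
    MvPowerSeries.constantCoeff_C, bidiff_eq_sum, map_sum, rankinCohen, Finset.smul_sum,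
    Finset.mul_sum]
  refine Finset.sum_congr rfl fun k hk => ?_
  have hk' : k ≤ m := Nat.lt_succ_iff.1 (Finset.mem_range.1 hk)
  simp only [map_mul, map_pow, map_neg, map_one, map_natCast]
  rw [← jet, ← jet, (flat_iff_jet φ).1 hφ, (flat_iff_jet ψ).1 hψ, flatJet_mul_flatJet,
    Nat.sub_add_cancel hk']
  -- Each of the `m` derivatives `∂/∂y²` carries a factor `-1/2`, which turns `-i/2` into `i/4`.
  have hc : weylCoeff m * ((-1) ^ k * (m.choose k : ℂ)) * (-1 / 2) ^ m =
      (Complex.I / 4) ^ m * (((-1) ^ k / (k.factorial : ℂ)) * (1 / ((m - k).factorial : ℂ))) := by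
    have h1 : (Complex.I / 4) ^ m = (-Complex.I / 2) ^ m * (-1 / 2) ^ m := by
      rw [← mul_pow]; congr 1; ring
    have h2 : (m.factorial : ℂ) ≠ 0 := Nat.cast_ne_zero.2 (Nat.factorial_ne_zero _)
    have h3 : (k.factorial : ℂ) ≠ 0 := Nat.cast_ne_zero.2 (Nat.factorial_ne_zero _)
    have h4 : ((m - k).factorial : ℂ) ≠ 0 := Nat.cast_ne_zero.2 (Nat.factorial_ne_zero _)
    rw [h1, weylCoeff, Nat.cast_choose ℂ hk']
    field_simp
  have hc' := congrArg (algebraMap ℂ Smooth) hc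
  simp only [map_mul, map_pow, map_neg, map_one, map_natCast] at hc'
  rw [← shiftedPochhammer, ← shiftedPochhammer]
  simp only [Algebra.smul_def, map_pow]
  linear_combination ((opX ^ k) (shiftedPochhammer k (m - k) (MvPowerSeries.constantCoeff φ)) *
    (opX ^ (m - k)) (shiftedPochhammer (m - k) k (MvPowerSeries.constantCoeff ψ))) * hc'

theorem fedosovStar_flat (f g : FormalFunctions) :
    fedosovStar flatConnection 0 f g = rcDeformation (Complex.I / 4) f g := by
  obtain ⟨ha, hσa⟩ := Classical.epsilon_spec (existsUnique_flatSection f).exists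
  obtain ⟨hb, hσb⟩ := Classical.epsilon_spec (existsUnique_flatSection g).exists
  rw [isFlatSection_flat_iff] at ha hb
  ext1 n
  rw [fedosovStar, coeff_sigma, sigmaInv, sigmaInv, coeff_weylMul, map_sum, rcDeformation,
    PowerSeries.coeff_mk]
  refine Finset.sum_congr rfl fun m _ => ?_
  rw [map_sum]
  refine Finset.sum_congr rfl fun p _ => ?_
  rw [constantCoeff_bidiff (ha p.1) (hb p.2), ← coeff_sigma, ← coeff_sigma, hσa, hσb]

end

end RankinCohenFedosov

/-- On `Õ = ℝ × ℝ⁺` with `ω = dx₁ ∧ dx₂`, Fedosov's construction with the flat symplectic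
connection `∇^{Õ}` and characteristic form `ω / (iħ)` (Weyl curvature `-ω`) has exactly one
normalised Fedosov `1`-form `r`, every formal function has exactly one flat lift, and the
resulting star product is the reduced Rankin–Cohen deformation `∑ t^n RC_n`, `t = iħ/4`. -/
theorem corollary3p4 :
    (∃! r : Fin 2 → RankinCohenFedosov.Weyl,
      RankinCohenFedosov.IsFedosovForm RankinCohenFedosov.flatConnection
        (-RankinCohenFedosov.omegaForm) r) ∧
    ∀ r : Fin 2 → RankinCohenFedosov.Weyl,
      RankinCohenFedosov.IsFedosovForm RankinCohenFedosov.flatConnection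
        (-RankinCohenFedosov.omegaForm) r →
      (∀ f : RankinCohenFedosov.FormalFunctions, ∃! a : RankinCohenFedosov.Weyl,
        RankinCohenFedosov.IsFlatSection RankinCohenFedosov.flatConnection r a ∧
          RankinCohenFedosov.sigma a = f) ∧
      ∀ f g : RankinCohenFedosov.FormalFunctions,
        RankinCohenFedosov.fedosovStar RankinCohenFedosov.flatConnection r f g =
          RankinCohenFedosov.rcDeformation (Complex.I / 4) f g := by
  refine ⟨⟨0, RankinCohenFedosov.isFedosovForm_zero, fun r hr => hr.eq_zero⟩, fun r hr => ?_⟩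
  rw [hr.eq_zero]
  exact ⟨RankinCohenFedosov.existsUnique_flatSection, RankinCohenFedosov.fedosovStar_flat⟩
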